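/- Let $d\ge 1$, let $S$ be a set of Borel probability measures on $\mathbb R^d$, and let $a\colon S\to[0,\infty)$ be a functional whose only zero is a given measure $\nu\in S$. Consider the Cauchy problem $$\partial_t\mu_t=\Delta\bigl(a(\mu_t)\mu_t\bigr),\qquad \mu_0=\nu, \tag{1}$$ that is, the nonlinear Fokker--Planck--Kolmogorov equation with diffusion matrix $A=a(\mu_t)I$ and drift $b=0$. A solution of (1) on $[0,T]$ is a flow $(\mu_t)_{t\in[0,T]}$ of probability measures in $S$ such that $t\mapsto\mu_t(B)$ is measurable for every Borel set $B$, the function $(x,t)\mapsto a(\mu_t)$ is integrable with respect to $\mu_t(dx)\,dt$ on $U\times[0,T]$ for every ball $U\subset\mathbb R^d$, and $$\int\varphi\,d\mu_t=\int\varphi\,d\nu+\int_0^t\int a(\mu_s)\,\Delta\varphi\,d\mu_s\,ds$$ for all $\varphi\in C_0^\infty(\mathbb R^d)$ and all $t\in[0,T]$. For $\beta>0$ let $f(\beta)$ be the value of $a$ at the measure with density $\Gamma(\beta,\cdot)*\nu$, where $\Gamma(\beta,x)=(4\pi\beta)^{-d/2}e^{-|x|^2/(4\beta)}$ is the fundamental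 solution of the heat operator $\partial_t-\Delta$. Then the stationary flow $\mu_t\equiv\nu$ is a solution of (1) on $[0,T]$ for every $T>0$. Moreover, the following are equivalent: 1. for every $T>0$ the problem (1) has on $[0,T]$ a solution different from the stationary one; 2. for all sufficiently small $\varepsilon>0$ the function $f$ is defined on $(0,\varepsilon)$ (that is, these measures belong to $S$) and $\displaystyle\int_0^\varepsilon\frac{dt}{f(t)}<\infty$. -/

import Mathlib

open MeasureTheory ProbabilityTheory Set
open scoped ContDiff

namespace FPK

/-- The Euclidean space `ℝ^d`. -/
abbrev E (d : ℕ) : Type := EuclideanSpace ℝ (Fin d)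

/-- Flows `(μ_t)`, `t ∈ [0, T]`, of measures on `ℝ^d` such that `t ↦ μ_t(B)` is measurable for every
Borel set `B`. Together with `IsMarkovKernel` this is a flow of probability measures. -/
abbrev Flow (d : ℕ) (T : ℝ) : Type := Kernel (Icc (0 : ℝ) T) (E d)

/-- Lebesgue measure `dt` on `[0, T]`. -/
noncomputable def timeMeasure (T : ℝ) : Measure (Icc (0 : ℝ) T) :=
  Measure.comap Subtype.val volume

/-- The measure `μ_t(dx) dt`, on `[0, T] × ℝ^d` (the time variable comes first). -/
noncomputable def spaceTime {d : ℕ} {T : ℝ} (μ : Flow d T) :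
    Measure (Icc (0 : ℝ) T × E d) :=
  Measure.compProd (timeMeasure T) μ

/-- The partial derivative `∂_{x_i} φ`. -/
noncomputable def partialDeriv {d : ℕ} (i : Fin d) (φ : E d → ℝ) (x : E d) : ℝ :=
  fderiv ℝ φ x (EuclideanSpace.single i 1)

/-- A matrix field `a^{ij}(μ, x, t)` depending on the flow `μ`, the point `x` and the time `t`. -/
abbrev DiffusionCoeff (d : ℕ) (T : ℝ) : Type :=
  Flow d T → E d → Icc (0 : ℝ) T → Matrix (Fin d) (Fin d) ℝ

/-- A vector field `b^i(μ, x, t)` depending on the flow `μ`, the point `x` and the time `t`. -/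
abbrev DriftCoeff (d : ℕ) (T : ℝ) : Type :=
  Flow d T → E d → Icc (0 : ℝ) T → Fin d → ℝ

/-- `L_μ φ (x, t) = a^{ij}(μ, x, t) ∂_{x_i} ∂_{x_j} φ(x) + b^i(μ, x, t) ∂_{x_i} φ(x)`. -/
noncomputable def generator {d : ℕ} {T : ℝ} (A : DiffusionCoeff d T) (b : DriftCoeff d T)
    (μ : Flow d T) (φ : E d → ℝ) (x : E d) (t : Icc (0 : ℝ) T) : ℝ :=
  ∑ i, ∑ j, A μ x t i j * partialDeriv i (partialDeriv j φ) x
    + ∑ i, b μ x t i * partialDeriv i φ x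

/-- `μ` is a solution on `[0, T]` of the Cauchy problem
`∂_t μ = ∂_{x_i} ∂_{x_j} (a^{ij}(μ, x, t) μ) - ∂_{x_i} (b^i(μ, x, t) μ)`, `μ|_{t = 0} = ν`,
where `dom` is the set of those flows for which the coefficients are defined. -/
structure IsSolution {d : ℕ} {T : ℝ} (dom : Set (Flow d T)) (A : DiffusionCoeff d T)
    (b : DriftCoeff d T) (ν : Measure (E d)) (μ : Flow d T) : Prop where
  /-- every `μ_t` is a probability measure -/
  isMarkov : IsMarkovKernel μ
  /-- the coefficients are defined for `μ` -/
  mem_dom : μ ∈ dom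
  /-- `a^{ij} ∈ L¹(μ, U × [0, T])` for each ball `U` -/
  integrable_diffusion : ∀ (z : E d) (r : ℝ) (i j : Fin d),
    IntegrableOn (fun p : Icc (0 : ℝ) T × E d => A μ p.2 p.1 i j)
      (univ ×ˢ Metric.ball z r) (spaceTime μ)
  /-- `b^i ∈ L¹(μ, U × [0, T])` for each ball `U` -/
  integrable_drift : ∀ (z : E d) (r : ℝ) (i : Fin d),
    IntegrableOn (fun p : Icc (0 : ℝ) T × E d => b μ p.2 p.1 i)
      (univ ×ˢ Metric.ball z r) (spaceTime μ)
  /-- `∫ φ dμ_t = ∫ φ dν + ∫_0^t ∫ L_μ φ dμ_s ds` for all `t ∈ [0, T]` and all smooth compactly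
  supported `φ` -/
  weak_eq : ∀ φ : E d → ℝ, ContDiff ℝ ∞ φ → HasCompactSupport φ → ∀ t : Icc (0 : ℝ) T,
    ∫ x, φ x ∂(μ t) = ∫ x, φ x ∂ν + ∫ s in Iic t, (∫ x, generator A b μ φ x s ∂(μ s)) ∂(timeMeasure T)

/-- The flows with values in the set `S` of measures. -/
def flowsIn {d : ℕ} (S : Set (Measure (E d))) (T : ℝ) : Set (Flow d T) :=
  {μ | ∀ t, μ t ∈ S}

/-- `A(μ, x, t) = a(μ_t) I`. -/
def scalarDiffusion {d : ℕ} (a : Measure (E d) → ℝ) (T : ℝ) : DiffusionCoeff d T :=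
  fun μ _ t => a (μ t) • (1 : Matrix (Fin d) (Fin d) ℝ)

/-- The stationary flow `μ_t = ν`. -/
noncomputable def stationary {d : ℕ} (ν : Measure (E d)) (T : ℝ) : Flow d T :=
  Kernel.const _ ν

/-- The fundamental solution `Γ(β, x) = (4πβ)^{-d/2} exp(-|x|²/(4β))` of the heat operator
`∂_t - Δ`, for `β > 0`. -/
noncomputable def heatKernel {d : ℕ} (β : ℝ) (x : E d) : ℝ :=
  (4 * Real.pi * β) ^ (-(d : ℝ) / 2) * Real.exp (-‖x‖ ^ 2 / (4 * β))

/-- The measure with Lebesgue density `Γ(β, ·) * ν`, for `β > 0`. -/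
noncomputable def heatEvolution {d : ℕ} (ν : Measure (E d)) (β : ℝ) : Measure (E d) :=
  volume.withDensity (fun x => ∫⁻ y, ENNReal.ofReal (heatKernel β (x - y)) ∂ν)

end FPK

/-!
A solution of `∂_t μ_t = Δ(a(μ_t) μ_t)` is the heat flow from `ν` run with the clock
`B(t) = ∫_0^t a(μ_s) ds`, so the problem reduces to the scalar equation `B' = f(B)`, `B(0) = 0`,
where `f(0) = 0`. This equation has a nonzero solution exactly when `∫_0^ε dβ / f(β) < ∞`.

Two ingredients make this rigorous for a functional `a` without any regularity.

* The change of clock. For `g ≥ 0` integrable on `(0, T]`, the generalized inverse `τ` of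
  `B(t) = ∫_0^t g` carries Lebesgue measure on `(0, B(T)]` to `g dt` (`map_primitiveInv`), because
  `τ(β) ≤ t ↔ β ≤ B(t)`. This replaces the chain rule for absolutely continuous functions, and
  transports measurability as well. It is used with `g(t) = a(μ_t)`, where it gives
  `∫_0^{B(T)} dβ / f(β) = |{t : a(μ_t) > 0}| ≤ T`, and with `g = 1 / f`, where `τ` is the clock of
  the solution to be constructed.
* The heat flow on the Fourier side. The characteristic function of `Γ(β, ·) * ν` is
  `exp (-β |ξ|²)` times that of `ν`. Fourier inversion of a test function then gives the weak heat
  equation (`integral_heatFlow`). Conversely, the weak equation of a solution, extended from test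
  functions to plane waves by cutoffs, is a linear ordinary differential equation for the
  characteristic function, so that `μ_t` is the heat flow at `B(t)` (`IsSolution.eq_heatFlow`).

The cutoffs need `a(μ_t) ∈ L¹(0, T)`, whereas a solution has integrability on `U × [0, T]` for balls
`U` only. Vague continuity in time and compactness of `[0, T]` provide a ball `U` with
`μ_t(U) ≥ 1/4` for all `t` (`IsSolution.exists_ball_le`), which closes this gap.
-/

namespace FPK

/-! ### Generalized inverse of a primitive -/

/-- The generalized inverse on `[0, T]` of the primitive `t ↦ ∫_0^t g` of a nonnegative function
`g`. The level `β` is truncated at the total mass `∫_0^T g`, so that the infimum is taken over a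
nonempty set. -/
noncomputable def primitiveInv (g : ℝ → ℝ) (T β : ℝ) : ℝ :=
  sInf {t ∈ Icc 0 T | min β (∫ s in (0)..T, g s) ≤ ∫ s in (0)..t, g s}

section primitiveInv

variable {g : ℝ → ℝ} {T : ℝ}

lemma intervalIntegrable_of_mem_Icc (hT : 0 ≤ T) (hgi : IntegrableOn g (Ioc 0 T)) {s t : ℝ}
    (hs : s ∈ Icc 0 T) (ht : t ∈ Icc 0 T) : IntervalIntegrable g volume s t := by
  rw [← intervalIntegrable_iff_integrableOn_Ioc_of_le hT] at hgi
  exact hgi.mono_set (by rw [uIcc_of_le hT]; exact uIcc_subset_Icc hs ht)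

lemma continuousOn_primitive_Icc (hT : 0 ≤ T) (hgi : IntegrableOn g (Ioc 0 T)) :
    ContinuousOn (fun t => ∫ s in (0)..t, g s) (Icc 0 T) := by
  have := intervalIntegral.continuousOn_primitive_interval' (a := 0) (b₁ := 0) (b₂ := T) (f := g)
    (μ := volume) (intervalIntegrable_of_mem_Icc hT hgi ⟨le_rfl, hT⟩ ⟨hT, le_rfl⟩) (by simp)
  rwa [uIcc_of_le hT] at this

lemma monotoneOn_primitive (hT : 0 ≤ T) (hg0 : ∀ s ∈ Ioc 0 T, 0 ≤ g s)
    (hgi : IntegrableOn g (Ioc 0 T)) :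
    MonotoneOn (fun t => ∫ s in (0)..t, g s) (Icc 0 T) := by
  intro s hs t ht hst
  have h0 : (0 : ℝ) ∈ Icc 0 T := ⟨le_rfl, hT⟩
  have := intervalIntegral.integral_interval_sub_left
    (intervalIntegrable_of_mem_Icc hT hgi h0 ht) (intervalIntegrable_of_mem_Icc hT hgi h0 hs)
  have h2 : 0 ≤ ∫ x in s..t, g x := by
    rw [intervalIntegral.integral_of_le hst]
    exact setIntegral_nonneg measurableSet_Ioc fun x hx =>
      hg0 x ⟨hs.1.trans_lt hx.1, hx.2.trans ht.2⟩
  simp only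
  linarith

lemma primitive_mem_Icc (hT : 0 ≤ T) (hg0 : ∀ s ∈ Ioc 0 T, 0 ≤ g s)
    (hgi : IntegrableOn g (Ioc 0 T)) {t : ℝ} (ht : t ∈ Icc 0 T) :
    ∫ s in (0)..t, g s ∈ Icc 0 (∫ s in (0)..T, g s) := by
  have hm := monotoneOn_primitive hT hg0 hgi
  refine ⟨?_, hm ht ⟨hT, le_rfl⟩ ht.2⟩
  have := hm ⟨le_rfl, hT⟩ ht ht.1
  simpa using this

lemma primitiveInv_mem_Icc (hT : 0 ≤ T) (β : ℝ) : primitiveInv g T β ∈ Icc 0 T := by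
  refine ⟨Real.sInf_nonneg fun t ht => ht.1.1, ?_⟩
  exact csInf_le ⟨0, fun t ht => ht.1.1⟩ ⟨⟨hT, le_rfl⟩, min_le_right _ _⟩

lemma monotone_primitiveInv (hT : 0 ≤ T) : Monotone (primitiveInv g T) := by
  intro β γ h
  refine csInf_le_csInf ⟨0, fun t ht => ht.1.1⟩ ⟨T, ⟨hT, le_rfl⟩, min_le_right _ _⟩ ?_
  rintro t ⟨ht, ht'⟩
  exact ⟨ht, (min_le_min_right _ h).trans ht'⟩

lemma measurable_primitiveInv (hT : 0 ≤ T) : Measurable (primitiveInv g T) :=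
  (monotone_primitiveInv hT).measurable

/-- The Galois connection between a primitive and its generalized inverse; the infimum is attained
because the primitive is continuous. -/
lemma primitiveInv_le_iff (hT : 0 ≤ T) (hg0 : ∀ s ∈ Ioc 0 T, 0 ≤ g s)
    (hgi : IntegrableOn g (Ioc 0 T)) {β t : ℝ} (hβ : β ≤ ∫ s in (0)..T, g s)
    (ht : t ∈ Icc 0 T) : primitiveInv g T β ≤ t ↔ β ≤ ∫ s in (0)..t, g s := by
  have hcl : IsClosed {t ∈ Icc 0 T | min β (∫ s in (0)..T, g s) ≤ ∫ s in (0)..t, g s} :=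
    isClosed_Icc.isClosed_le continuousOn_const (continuousOn_primitive_Icc hT hgi)
  have hmem := hcl.csInf_mem ⟨T, ⟨hT, le_rfl⟩, min_le_right _ _⟩ ⟨0, fun t ht => ht.1.1⟩
  rw [min_eq_left hβ] at hmem
  constructor
  · intro h
    rw [primitiveInv, min_eq_left hβ] at h
    exact hmem.2.trans (monotoneOn_primitive hT hg0 hgi hmem.1 ht h)
  · intro h
    exact csInf_le ⟨0, fun t ht => ht.1.1⟩ ⟨ht, (min_le_left _ _).trans h⟩

lemma primitive_primitiveInv (hT : 0 ≤ T) (hg0 : ∀ s ∈ Ioc 0 T, 0 ≤ g s)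
    (hgi : IntegrableOn g (Ioc 0 T)) {β : ℝ} (hβ : β ∈ Icc 0 (∫ s in (0)..T, g s)) :
    ∫ s in (0)..primitiveInv g T β, g s = β := by
  have hτ := primitiveInv_mem_Icc (g := g) hT β
  have h1 := (primitiveInv_le_iff hT hg0 hgi hβ.2 hτ).1 le_rfl
  obtain ⟨s, hs, hsβ⟩ := intermediate_value_Icc hT (continuousOn_primitive_Icc hT hgi)
    (by simpa using hβ)
  have h2 := (primitiveInv_le_iff hT hg0 hgi hβ.2 hs).2 (le_of_eq hsβ.symm)
  exact le_antisymm ((monotoneOn_primitive hT hg0 hgi hτ hs h2).trans hsβ.le) h1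

lemma primitiveInv_preimage_Iic_inter (hT : 0 ≤ T) (hg0 : ∀ s ∈ Ioc 0 T, 0 ≤ g s)
    (hgi : IntegrableOn g (Ioc 0 T)) {t : ℝ} (ht : t ∈ Icc 0 T) :
    primitiveInv g T ⁻¹' Iic t ∩ Ioc 0 (∫ s in (0)..T, g s) = Ioc 0 (∫ s in (0)..t, g s) := by
  have hB := primitive_mem_Icc hT hg0 hgi ht
  ext β
  simp only [mem_inter_iff, mem_preimage, mem_Iic, mem_Ioc]
  constructor
  · rintro ⟨h1, h2, h3⟩
    exact ⟨h2, (primitiveInv_le_iff hT hg0 hgi h3 ht).1 h1⟩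
  · rintro ⟨h2, h3⟩
    exact ⟨(primitiveInv_le_iff hT hg0 hgi (h3.trans hB.2) ht).2 h3, h2, h3.trans hB.2⟩

/-- The generalized inverse of `t ↦ ∫_0^t g` carries Lebesgue measure to `g dt`: by the Galois
connection `primitiveInv_le_iff` both measures give `[0, t]` the mass `∫_0^t g`. Neither continuity
nor strict positivity of `g` is needed, and no absolute continuity theory. -/
lemma map_primitiveInv (hT : 0 ≤ T) (hg0 : ∀ s ∈ Ioc 0 T, 0 ≤ g s)
    (hgi : IntegrableOn g (Ioc 0 T)) :
    Measure.map (primitiveInv g T) (volume.restrict (Ioc 0 (∫ s in (0)..T, g s))) =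
      (volume.restrict (Ioc 0 T)).withDensity (fun s => ENNReal.ofReal (g s)) := by
  have hfin : IsFiniteMeasure
      ((volume.restrict (Ioc 0 T)).withDensity (fun s => ENNReal.ofReal (g s))) :=
    isFiniteMeasure_withDensity_ofReal hgi.2
  -- mass of `(-∞, t]` for `t ∈ [0, T]`
  have key : ∀ t ∈ Icc 0 T,
      Measure.map (primitiveInv g T) (volume.restrict (Ioc 0 (∫ s in (0)..T, g s))) (Iic t) =
      (volume.restrict (Ioc 0 T)).withDensity (fun s => ENNReal.ofReal (g s)) (Iic t) := by
    intro t ht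
    have hB := primitive_mem_Icc hT hg0 hgi ht
    rw [Measure.map_apply (measurable_primitiveInv hT) measurableSet_Iic,
      Measure.restrict_apply (measurable_primitiveInv hT measurableSet_Iic),
      withDensity_apply _ measurableSet_Iic, Measure.restrict_restrict measurableSet_Iic]
    rw [primitiveInv_preimage_Iic_inter hT hg0 hgi ht, Iic_inter_Ioc_of_le ht.2, Real.volume_Ioc,
      sub_zero, intervalIntegral.integral_of_le ht.1,
      ofReal_integral_eq_lintegral_ofReal (hgi.mono_set (Ioc_subset_Ioc_right ht.2))]
    exact (ae_restrict_iff' measurableSet_Ioc).2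
      (ae_of_all _ fun s hs => hg0 s ⟨hs.1, hs.2.trans ht.2⟩)
  refine Measure.ext_of_Iic _ _ fun t => ?_
  rcases lt_or_ge t 0 with h0 | h0
  · have z1 : Measure.map (primitiveInv g T) (volume.restrict (Ioc 0 (∫ s in (0)..T, g s)))
        (Iic t) = 0 := by
      rw [Measure.map_apply (measurable_primitiveInv hT) measurableSet_Iic]
      have : primitiveInv g T ⁻¹' Iic t = ∅ := by
        ext β
        have := (primitiveInv_mem_Icc (g := g) hT β).1
        simp only [mem_preimage, mem_Iic, mem_empty_iff_false, iff_false, not_le]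
        linarith
      simp [this]
    have z2 : Iic t ∩ Ioc 0 T = ∅ := by
      ext s
      simp only [mem_inter_iff, mem_Iic, mem_Ioc, mem_empty_iff_false, iff_false]
      intro h
      linarith [h.1, h.2.1]
    rw [z1, withDensity_apply _ measurableSet_Iic, Measure.restrict_restrict measurableSet_Iic, z2]
    simp
  · rcases le_total t T with h1 | h1
    · exact key t ⟨h0, h1⟩
    · have k := key T ⟨hT, le_rfl⟩
      have e1 : ∀ r, T ≤ r → primitiveInv g T ⁻¹' Iic r = univ := by
        intro r hr
        ext β
        simpa using (primitiveInv_mem_Icc (g := g) hT β).2.trans hr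
      have e2 : ∀ r, T ≤ r → Iic r ∩ Ioc 0 T = Ioc 0 T := fun r hr =>
        inter_eq_right.2 fun s hs => hs.2.trans hr
      rw [Measure.map_apply (measurable_primitiveInv hT) measurableSet_Iic,
        withDensity_apply _ measurableSet_Iic, Measure.restrict_restrict measurableSet_Iic] at k ⊢
      rw [e1 t h1, e2 t h1]
      rwa [e1 T le_rfl, e2 T le_rfl] at k

lemma integrableOn_comp_primitiveInv_iff (hT : 0 ≤ T) (hg0 : ∀ s ∈ Ioc 0 T, 0 ≤ g s)
    (hgi : IntegrableOn g (Ioc 0 T)) {u : ℝ → ℝ}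
    (hu : AEStronglyMeasurable u (volume.restrict (Ioc 0 T))) :
    IntegrableOn (fun β => u (primitiveInv g T β)) (Ioc 0 (∫ s in (0)..T, g s)) ↔
      IntegrableOn (fun s => g s * u s) (Ioc 0 T) := by
  have hu' := hu.mono_ac (withDensity_absolutelyContinuous (volume.restrict (Ioc 0 T))
    (fun s => ENNReal.ofReal (g s)))
  have h1 := integrable_map_measure (f := primitiveInv g T) (g := u)
    (μ := volume.restrict (Ioc 0 (∫ s in (0)..T, g s)))
    (by rwa [map_primitiveInv hT hg0 hgi]) (measurable_primitiveInv hT).aemeasurable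
  rw [map_primitiveInv hT hg0 hgi, integrable_withDensity_iff_integrable_smul₀'
    hgi.1.aemeasurable.ennreal_ofReal (ae_of_all _ fun _ => ENNReal.ofReal_lt_top)] at h1
  rw [IntegrableOn, IntegrableOn]
  refine h1.symm.trans (integrable_congr ?_)
  refine (ae_restrict_iff' measurableSet_Ioc).2 (ae_of_all _ fun s hs => ?_)
  simp [ENNReal.toReal_ofReal (hg0 s hs)]

/-- The change of variables `β = ∫_0^s g`, for `u` that is merely measurable. -/
lemma intervalIntegral_comp_primitiveInv (hT : 0 ≤ T) (hg0 : ∀ s ∈ Ioc 0 T, 0 ≤ g s)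
    (hgi : IntegrableOn g (Ioc 0 T)) {u : ℝ → ℝ}
    (hu : AEStronglyMeasurable u (volume.restrict (Ioc 0 T))) {t : ℝ} (ht : t ∈ Icc 0 T) :
    ∫ β in (0)..∫ s in (0)..t, g s, u (primitiveInv g T β) = ∫ s in (0)..t, g s * u s := by
  have hB := primitive_mem_Icc hT hg0 hgi ht
  have hu' := hu.mono_ac (withDensity_absolutelyContinuous (volume.restrict (Ioc 0 T))
    (fun s => ENNReal.ofReal (g s)))
  rw [intervalIntegral.integral_of_le hB.1, ← primitiveInv_preimage_Iic_inter hT hg0 hgi ht,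
    ← Measure.restrict_restrict (measurable_primitiveInv hT measurableSet_Iic),
    ← setIntegral_map measurableSet_Iic (by rwa [map_primitiveInv hT hg0 hgi])
      (measurable_primitiveInv hT).aemeasurable,
    map_primitiveInv hT hg0 hgi, setIntegral_withDensity_eq_setIntegral_toReal_smul₀
      (hgi.1.aemeasurable.ennreal_ofReal.restrict) (ae_of_all _ fun _ => ENNReal.ofReal_lt_top)
      _ measurableSet_Iic, Measure.restrict_restrict measurableSet_Iic,
    Iic_inter_Ioc_of_le ht.2, intervalIntegral.integral_of_le ht.1]
  refine setIntegral_congr_fun measurableSet_Ioc fun s hs => ?_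
  simp [ENNReal.toReal_ofReal (hg0 s ⟨hs.1, hs.2.trans ht.2⟩)]

end primitiveInv

/-! ### The linear equation in integrated form -/

/-- A solution of `k' = -c k`, in integrated form, is an exponential. -/
lemma eq_exp_of_integral_eq {k : ℝ → ℝ} {L c h₀ : ℝ} (hL : 0 ≤ L) (hk : IntegrableOn k (Ioc 0 L))
    (h : ∀ β ∈ Icc 0 L, k β = h₀ - c * ∫ r in (0)..β, k r) {β : ℝ} (hβ : β ∈ Icc 0 L) :
    k β = h₀ * Real.exp (-(c * β)) := by
  have hKc := continuousOn_primitive_Icc hL hk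
  have hkc : ContinuousOn k (Icc 0 L) :=
    (continuousOn_const.sub (continuousOn_const.mul hKc)).congr h
  have hcont : ContinuousOn (fun β => (h₀ - c * ∫ r in (0)..β, k r) * Real.exp (c * β)) (Icc 0 L) :=
    (continuousOn_const.sub (continuousOn_const.mul hKc)).mul (by fun_prop)
  -- `k e^{cβ}`, written through the primitive of `k`, is constant
  have hconst := constant_of_has_deriv_right_zero hcont (fun x hx => by
    have hx' : x ∈ Icc 0 L := Ico_subset_Icc_self hx
    have hd : HasDerivWithinAt (fun β => ∫ r in (0)..β, k r) (k x) (Ici x) x := by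
      refine intervalIntegral.integral_hasDerivWithinAt_right
        (intervalIntegrable_of_mem_Icc hL hk ⟨le_rfl, hL⟩ hx') (t := Ioi x) ?_ ?_
      · refine ⟨Ioc x L, ?_, ?_⟩
        · exact Ioc_mem_nhdsGT hx.2
        · exact (hk.mono_set (Ioc_subset_Ioc_left hx.1)).1
      · exact ((hkc x hx').mono_of_mem_nhdsWithin (by
          exact Filter.mem_of_superset (Ioc_mem_nhdsGT hx.2)
            fun y hy => ⟨hx.1.trans hy.1.le, hy.2⟩))
    have h1 := ((hd.const_mul c).const_sub h₀).mul
      (((hasDerivAt_id x).const_mul c).exp.hasDerivWithinAt (s := Ici x))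
    refine h1.congr_deriv ?_
    simp only [id]
    rw [← h x hx']
    ring) β hβ
  simp only [intervalIntegral.integral_same, mul_zero, sub_zero, Real.exp_zero, mul_one] at hconst
  rw [← h β hβ] at hconst
  rw [← hconst, mul_assoc, ← Real.exp_add]
  simp

/-- A solution of `h' = -c g h`, in integrated form, is the exponential of the primitive of `g`. -/
lemma eq_exp_primitive {g h : ℝ → ℝ} {T c h₀ K : ℝ} (hT : 0 ≤ T) (hg0 : ∀ s ∈ Ioc 0 T, 0 ≤ g s)
    (hgi : IntegrableOn g (Ioc 0 T)) (hh : Measurable h) (hK : ∀ s, |h s| ≤ K)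
    (heq : ∀ t ∈ Icc 0 T, h t = h₀ - c * ∫ s in (0)..t, g s * h s) {t : ℝ} (ht : t ∈ Icc 0 T) :
    h t = h₀ * Real.exp (-(c * ∫ s in (0)..t, g s)) := by
  -- the new time `β = ∫_0^t g` turns the equation into `k' = -c k`
  set k : ℝ → ℝ := fun β => h (primitiveInv g T β) with hk
  have hch : ∀ t ∈ Icc 0 T, h t = h₀ - c * ∫ β in (0)..∫ s in (0)..t, g s, k β := fun t ht => by
    rw [heq t ht, hk, intervalIntegral_comp_primitiveInv hT hg0 hgi hh.aestronglyMeasurable ht]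
  have hL := (primitive_mem_Icc hT hg0 hgi ht)
  have hki : IntegrableOn k (Ioc 0 (∫ s in (0)..T, g s)) :=
    Integrable.of_bound (hh.comp (measurable_primitiveInv hT)).aestronglyMeasurable K
      (ae_of_all _ fun _ => hK _)
  have hkeq : ∀ β ∈ Icc 0 (∫ s in (0)..T, g s), k β = h₀ - c * ∫ r in (0)..β, k r := by
    intro β hβ
    have := hch _ (primitiveInv_mem_Icc (g := g) hT β)
    rwa [primitive_primitiveInv hT hg0 hgi hβ] at this
  rw [hch t ht, ← hkeq _ hL, eq_exp_of_integral_eq (hL.1.trans hL.2) hki hkeq hL]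

/-! ### The heat flow of a measure -/

variable {d : ℕ}

lemma heatKernel_nonneg {β : ℝ} (hβ : 0 < β) (x : E d) : 0 ≤ heatKernel β x := by
  unfold heatKernel; positivity

lemma measurable_heatKernel : Measurable (fun p : ℝ × E d => heatKernel p.1 p.2) := by
  unfold heatKernel
  fun_prop

/-- The Fourier transform of the Gaussian density `Γ(β, ·)`. -/
lemma integral_heatKernel_mul_cexp {β : ℝ} (hβ : 0 < β) (ξ : E d) :
    ∫ x : E d, (heatKernel β x : ℂ) * Complex.exp (inner ℝ x ξ * Complex.I) =
      Complex.exp (-(β * ‖ξ‖ ^ 2)) := by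
  have hb : (0 : ℝ) < ((1 / (4 * β) : ℝ) : ℂ).re := by rw [Complex.ofReal_re]; positivity
  have h := GaussianFourier.integral_cexp_neg_mul_sq_norm_add hb Complex.I ξ
  have hpos : 0 < 4 * Real.pi * β := by positivity
  have e : ∀ x : E d, (heatKernel β x : ℂ) * Complex.exp (inner ℝ x ξ * Complex.I) =
      ((4 * Real.pi * β : ℝ) : ℂ) ^ (-(d : ℂ) / 2) *
        Complex.exp (-((1 / (4 * β) : ℝ) : ℂ) * ‖x‖ ^ 2 + Complex.I * inner ℝ ξ x) := by
    intro x
    unfold heatKernel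
    rw [Complex.ofReal_mul, Complex.ofReal_cpow hpos.le, Complex.ofReal_exp, mul_assoc,
      ← Complex.exp_add, real_inner_comm]
    push_cast
    congr 2
    ring
  simp_rw [e]
  rw [integral_const_mul, h, ← mul_assoc]
  have hβ' : (β : ℂ) ≠ 0 := by exact_mod_cast hβ.ne'
  have e2 : (Real.pi : ℂ) / ((1 / (4 * β) : ℝ) : ℂ) = ((4 * Real.pi * β : ℝ) : ℂ) := by
    push_cast; field_simp
  have hne : ((4 * Real.pi * β : ℝ) : ℂ) ≠ 0 := by exact_mod_cast hpos.ne'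
  rw [e2, ← Complex.cpow_add _ _ hne, finrank_euclideanSpace_fin]
  have e3 : -(d : ℂ) / 2 + (d : ℂ) / 2 = 0 := by ring
  rw [e3, Complex.cpow_zero, one_mul, Complex.I_sq]
  congr 1
  push_cast
  field_simp

lemma integral_heatKernel {β : ℝ} (hβ : 0 < β) : ∫ x : E d, heatKernel β x = 1 := by
  have h := integral_heatKernel_mul_cexp (d := d) hβ 0
  simp only [inner_zero_right, Complex.ofReal_zero, zero_mul, Complex.exp_zero, mul_one,
    norm_zero, ne_eq, OfNat.ofNat_ne_zero, not_false_eq_true, zero_pow, mul_zero, neg_zero] at h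
  rw [integral_complex_ofReal] at h
  exact_mod_cast h

/-- The Gaussian measure with density `Γ(β, ·)`. -/
noncomputable def heatMeasure (d : ℕ) (β : ℝ) : Measure (E d) :=
  volume.withDensity (fun x => ENNReal.ofReal (heatKernel β x))

lemma isProbabilityMeasure_heatMeasure {β : ℝ} (hβ : 0 < β) :
    IsProbabilityMeasure (heatMeasure d β) := by
  constructor
  have hi : Integrable (fun x : E d => heatKernel β x) :=
    Integrable.of_integral_ne_zero (by rw [integral_heatKernel hβ]; simp)
  rw [heatMeasure, withDensity_apply _ MeasurableSet.univ, Measure.restrict_univ,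
    ← ofReal_integral_eq_lintegral_ofReal hi (ae_of_all _ (heatKernel_nonneg hβ)),
    integral_heatKernel hβ, ENNReal.ofReal_one]

lemma charFun_heatMeasure {β : ℝ} (hβ : 0 < β) (ξ : E d) :
    charFun (heatMeasure d β) ξ = Complex.exp (-(β * ‖ξ‖ ^ 2)) := by
  have hm : Measurable (fun x : E d => ENNReal.ofReal (heatKernel β x)) :=
    (measurable_heatKernel.comp measurable_prodMk_left).ennreal_ofReal
  rw [charFun_apply, heatMeasure, integral_withDensity_eq_integral_toReal_smul hm
    (ae_of_all _ fun _ => ENNReal.ofReal_lt_top), ← integral_heatKernel_mul_cexp hβ]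
  refine integral_congr_ae (ae_of_all _ fun x => ?_)
  simp only [ENNReal.toReal_ofReal (heatKernel_nonneg hβ x), Complex.real_smul]

lemma heatEvolution_eq_conv (ν : Measure (E d)) [IsProbabilityMeasure ν] {β : ℝ} (hβ : 0 < β) :
    heatEvolution ν β = ν.conv (heatMeasure d β) := by
  have := isProbabilityMeasure_heatMeasure (d := d) hβ
  have hm : Measurable (fun x : E d => ENNReal.ofReal (heatKernel β x)) :=
    (measurable_heatKernel.comp measurable_prodMk_left).ennreal_ofReal
  ext A hA
  rw [heatEvolution, withDensity_apply _ hA, ← lintegral_indicator_one hA,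
    Measure.lintegral_conv (measurable_one.indicator hA), ← lintegral_indicator hA]
  have e : ∀ x, A.indicator (fun x => ∫⁻ y, ENNReal.ofReal (heatKernel β (x - y)) ∂ν) x =
      ∫⁻ y, A.indicator 1 x * ENNReal.ofReal (heatKernel β (x - y)) ∂ν := by
    intro x
    by_cases hx : x ∈ A <;> simp [hx]
  simp_rw [e]
  have hm2 : Measurable (fun p : E d × E d =>
      A.indicator (1 : E d → ENNReal) p.1 * ENNReal.ofReal (heatKernel β (p.1 - p.2))) :=
    ((measurable_one.indicator hA).comp measurable_fst).mul
      (hm.comp (measurable_fst.sub measurable_snd))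
  rw [lintegral_lintegral_swap hm2.aemeasurable]
  refine lintegral_congr fun y => ?_
  have hm3 : Measurable (fun x : E d => A.indicator (1 : E d → ENNReal) (y + x)) :=
    (measurable_one.indicator hA).comp (measurable_const_add y)
  rw [heatMeasure, lintegral_withDensity_eq_lintegral_mul _ hm hm3,
    ← lintegral_add_left_eq_self _ y]
  refine lintegral_congr fun x => ?_
  simp [mul_comm]

lemma isProbabilityMeasure_heatEvolution (ν : Measure (E d)) [IsProbabilityMeasure ν] {β : ℝ}
    (hβ : 0 < β) : IsProbabilityMeasure (heatEvolution ν β) := by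
  have := isProbabilityMeasure_heatMeasure (d := d) hβ
  rw [heatEvolution_eq_conv ν hβ]
  infer_instance

lemma charFun_heatEvolution (ν : Measure (E d)) [IsProbabilityMeasure ν] {β : ℝ} (hβ : 0 < β)
    (ξ : E d) :
    charFun (heatEvolution ν β) ξ = charFun ν ξ * Complex.exp (-(β * ‖ξ‖ ^ 2)) := by
  have := isProbabilityMeasure_heatMeasure (d := d) hβ
  rw [heatEvolution_eq_conv ν hβ, charFun_conv, charFun_heatMeasure hβ]

/-- The heat flow moves every measure: on a neighbourhood of `0` the characteristic function of `ν`
does not vanish, and it gets multiplied by `exp (-β |ξ|²) ≠ 1`. -/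
lemma heatEvolution_ne (hd : 0 < d) (ν : Measure (E d)) [IsProbabilityMeasure ν] {β : ℝ}
    (hβ : 0 < β) : heatEvolution ν β ≠ ν := by
  intro h
  have h0 : charFun ν (0 : E d) ≠ 0 := by simp
  have hcont : Continuous (charFun ν) := continuous_charFun
  let e : E d := EuclideanSpace.single ⟨0, hd⟩ 1
  have htend : Filter.Tendsto (fun s : ℝ => charFun ν (s • e)) (nhdsWithin 0 (Ioi 0))
      (nhds (charFun ν (0 : E d))) := by
    have : Continuous fun s : ℝ => charFun ν (s • e) := hcont.comp (by fun_prop)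
    simpa using (this.tendsto 0).mono_left nhdsWithin_le_nhds
  obtain ⟨s, hs0, hs⟩ := ((htend.eventually_ne h0).and self_mem_nhdsWithin).exists
  have h1 := charFun_heatEvolution ν hβ (s • e)
  rw [h] at h1
  have h2 : Complex.exp (-(β * ‖s • e‖ ^ 2)) = 1 :=
    mul_left_cancel₀ hs0 (by rw [← h1, mul_one])
  have h3 : Real.exp (-(β * ‖s • e‖ ^ 2)) = 1 := by exact_mod_cast h2
  rw [Real.exp_eq_one_iff, neg_eq_zero] at h3
  have hpos : 0 < ‖s • e‖ := by
    have he : e ≠ 0 := by simp [e]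
    exact norm_pos_iff.2 (smul_ne_zero (ne_of_gt hs) he)
  have : 0 < β * ‖s • e‖ ^ 2 := by positivity
  linarith

/-- The heat flow started at `ν`, extended by `ν` to nonpositive times. -/
noncomputable def heatFlow (ν : Measure (E d)) (β : ℝ) : Measure (E d) :=
  if 0 < β then heatEvolution ν β else ν

lemma heatFlow_of_pos (ν : Measure (E d)) {β : ℝ} (hβ : 0 < β) :
    heatFlow ν β = heatEvolution ν β := if_pos hβ

lemma heatFlow_of_nonpos (ν : Measure (E d)) {β : ℝ} (hβ : β ≤ 0) : heatFlow ν β = ν :=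
  if_neg hβ.not_gt

instance isProbabilityMeasure_heatFlow (ν : Measure (E d)) [IsProbabilityMeasure ν] (β : ℝ) :
    IsProbabilityMeasure (heatFlow ν β) := by
  unfold heatFlow
  split_ifs with h
  · exact isProbabilityMeasure_heatEvolution ν h
  · infer_instance

lemma charFun_heatFlow (ν : Measure (E d)) [IsProbabilityMeasure ν] {β : ℝ} (hβ : 0 ≤ β)
    (ξ : E d) : charFun (heatFlow ν β) ξ = charFun ν ξ * Complex.exp (-(β * ‖ξ‖ ^ 2)) := by
  rcases hβ.eq_or_lt with rfl | h
  · simp [heatFlow_of_nonpos]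
  · rw [heatFlow_of_pos ν h, charFun_heatEvolution ν h]

lemma measurable_heatFlow (ν : Measure (E d)) [IsProbabilityMeasure ν] :
    Measurable (heatFlow ν) := by
  refine Measurable.ite measurableSet_Ioi ?_ measurable_const
  refine Measure.measurable_of_measurable_coe _ fun A hA => ?_
  simp_rw [heatEvolution, withDensity_apply _ hA]
  have h1 : Measurable (fun p : (ℝ × E d) × E d =>
      ENNReal.ofReal (heatKernel p.1.1 (p.1.2 - p.2))) := by
    have hk : Measurable (fun p : (ℝ × E d) × E d => (p.1.1, p.1.2 - p.2)) := by fun_prop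
    exact (measurable_heatKernel.comp hk).ennreal_ofReal
  have h2 : Measurable (fun p : ℝ × E d => ∫⁻ y, ENNReal.ofReal (heatKernel p.1 (p.2 - y)) ∂ν) :=
    h1.lintegral_prod_right'
  exact h2.lintegral_prod_right'

/-! ### The weak heat equation -/

/-- The Laplacian `∑ i, ∂_{x_i}² φ`, in terms of `partialDeriv`. -/
noncomputable def laplace (φ : E d → ℝ) (x : E d) : ℝ :=
  ∑ i, partialDeriv i (partialDeriv i φ) x

lemma contDiff_partialDeriv (i : Fin d) {φ : E d → ℝ} (hφ : ContDiff ℝ ∞ φ) :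
    ContDiff ℝ ∞ (partialDeriv i φ) := by
  have := (contDiff_infty_iff_fderiv.1 hφ).2
  exact this.clm_apply contDiff_const

lemma hasCompactSupport_partialDeriv (i : Fin d) {φ : E d → ℝ} (hφ : HasCompactSupport φ) :
    HasCompactSupport (partialDeriv i φ) :=
  hφ.fderiv_apply (𝕜 := ℝ) _

lemma continuous_laplace {φ : E d → ℝ} (hφ : ContDiff ℝ ∞ φ) : Continuous (laplace φ) :=
  continuous_finsetSum _ fun i _ =>
    (contDiff_partialDeriv i (contDiff_partialDeriv i hφ)).continuous

lemma hasCompactSupport_laplace {φ : E d → ℝ} (hφ : HasCompactSupport φ) :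
    HasCompactSupport (laplace φ) := by
  have : ∀ s : Finset (Fin d), HasCompactSupport
      (fun x => ∑ i ∈ s, partialDeriv i (partialDeriv i φ) x) := by
    intro s
    induction s using Finset.induction_on with
    | empty =>
      simp only [Finset.sum_empty]
      exact HasCompactSupport.zero
    | insert i s hi ih =>
      simp_rw [Finset.sum_insert hi]
      exact (hasCompactSupport_partialDeriv i (hasCompactSupport_partialDeriv i hφ)).add ih
  exact this Finset.univ

lemma exists_abs_le_of_hasCompactSupport {φ : E d → ℝ} (hφ : Continuous φ)
    (hc : HasCompactSupport φ) : ∃ C, ∀ x, |φ x| ≤ C :=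
  hc.exists_bound_of_continuous hφ

section fourier

open FourierTransform SchwartzMap LineDeriv Laplacian

/-- Parseval's identity for a Schwartz function and a probability measure. -/
lemma integral_eq_integral_fourier_mul_charFun (m : Measure (E d)) [IsProbabilityMeasure m]
    (f : 𝓢(E d, ℂ)) :
    ∫ x, f x ∂m = ∫ ξ, 𝓕 f ξ * charFun m ((2 * Real.pi) • ξ) := by
  have h1 : ∀ x, f x =
      ∫ ξ, Complex.exp (((2 * Real.pi * inner ℝ ξ x : ℝ) : ℂ) * Complex.I) * 𝓕 f ξ := by
    intro x
    have h0 : 𝓕⁻ (𝓕 f) = f := FourierTransform.fourierInv_fourier_eq f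
    conv_lhs => rw [← h0]
    rw [fourierInv_coe, Real.fourierInv_eq']
    rfl
  have hint : Integrable (Function.uncurry fun (x ξ : E d) =>
      Complex.exp (((2 * Real.pi * inner ℝ ξ x : ℝ) : ℂ) * Complex.I) * 𝓕 f ξ)
      (m.prod volume) := by
    have hf : Integrable (fun p : E d × E d => 𝓕 f p.2) (m.prod volume) :=
      (𝓕 f).integrable.comp_snd m
    refine hf.bdd_mul (c := 1) (Continuous.aestronglyMeasurable (by fun_prop)) ?_
    exact ae_of_all _ fun p => (Complex.norm_exp_ofReal_mul_I _).le
  calc ∫ x, f x ∂m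
      = ∫ x, (∫ ξ, Complex.exp (((2 * Real.pi * inner ℝ ξ x : ℝ) : ℂ) * Complex.I) * 𝓕 f ξ) ∂m := by
        exact integral_congr_ae (ae_of_all _ h1)
    _ = ∫ ξ, (∫ x, Complex.exp (((2 * Real.pi * inner ℝ ξ x : ℝ) : ℂ) * Complex.I) * 𝓕 f ξ ∂m) :=
        integral_integral_swap hint
    _ = _ := by
        refine integral_congr_ae (ae_of_all _ fun ξ => ?_)
        simp only
        rw [integral_mul_const, mul_comm, charFun_apply]
        congr 2
        ext x
        rw [inner_smul_right, real_inner_comm]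

lemma fourier_laplacian_apply (f : 𝓢(E d, ℂ)) (ξ : E d) :
    𝓕 (Δ f) ξ = -((2 * Real.pi) ^ 2 * ‖ξ‖ ^ 2 : ℝ) * 𝓕 f ξ := by
  rw [laplacian_eq_fourierMultiplierCLM, fourierMultiplierCLM_apply, FourierTransform.fourier_smul,
    FourierTransform.fourier_fourierInv_eq, _root_.smul_apply,
    smulLeftCLM_apply_apply (by fun_prop), smul_smul, Complex.real_smul]
  push_cast
  ring

/-- The heat equation for `heatFlow ν`, tested with Schwartz functions: on the Fourier side it is
the identity `e^{-cβ} - 1 = ∫_0^β -c e^{-cr} dr`. -/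
lemma integral_heatFlow_schwartz (ν : Measure (E d)) [IsProbabilityMeasure ν] (f : 𝓢(E d, ℂ))
    {β : ℝ} (hβ : 0 ≤ β) :
    ∫ x, f x ∂(heatFlow ν β) =
      ∫ x, f x ∂ν + ∫ r in (0)..β, ∫ x, Δ f x ∂(heatFlow ν r) := by
  set c : E d → ℝ := fun ξ => (2 * Real.pi) ^ 2 * ‖ξ‖ ^ 2 with hc
  set F : ℝ → E d → ℂ := fun r ξ =>
    𝓕 (Δ f) ξ * (charFun ν ((2 * Real.pi) • ξ) * Complex.exp (-(r * c ξ))) with hF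
  have hnorm : ∀ ξ : E d, ‖(2 * Real.pi) • ξ‖ ^ 2 = c ξ := fun ξ => by
    rw [norm_smul, mul_pow, Real.norm_eq_abs, sq_abs]
  have hchar : ∀ (r : ℝ), 0 ≤ r → ∀ ξ : E d, charFun (heatFlow ν r) ((2 * Real.pi) • ξ) =
      charFun ν ((2 * Real.pi) • ξ) * Complex.exp (-(r * c ξ)) := by
    intro r hr ξ
    rw [charFun_heatFlow ν hr, ← hnorm]
    push_cast
    rfl
  have h1 : ∫ r in (0)..β, ∫ x, Δ f x ∂(heatFlow ν r) = ∫ r in (0)..β, ∫ ξ, F r ξ := by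
    refine intervalIntegral.integral_congr fun r hr => ?_
    rw [uIcc_of_le hβ] at hr
    rw [integral_eq_integral_fourier_mul_charFun]
    simp_rw [hchar r hr.1]
    rfl
  have hcont : Continuous (charFun ν) := continuous_charFun
  have hint : Integrable (Function.uncurry F) ((volume.restrict (Ioc 0 β)).prod volume) := by
    have hf : Integrable (fun p : ℝ × E d => 𝓕 (Δ f) p.2)
        ((volume.restrict (Ioc 0 β)).prod volume) :=
      (𝓕 (Δ f)).integrable.comp_snd (volume.restrict (Ioc 0 β))
    refine hf.mul_bdd (c := 1) (Continuous.aestronglyMeasurable (by fun_prop)) ?_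
    have hae : ∀ᵐ p ∂((volume.restrict (Ioc 0 β)).prod (volume : Measure (E d))),
        p.1 ∈ Ioc 0 β :=
      Measure.quasiMeasurePreserving_fst.ae (ae_restrict_mem measurableSet_Ioc)
    filter_upwards [hae] with p hp
    rw [norm_mul, Complex.norm_exp]
    refine mul_le_one₀ (norm_charFun_le_one _) (Real.exp_nonneg _) (Real.exp_le_one_iff.2 ?_)
    have : 0 ≤ p.1 * c p.2 := mul_nonneg hp.1.le (by simp only [hc]; positivity)
    have e : (-((p.1 : ℂ) * (c p.2 : ℂ))).re = -(p.1 * c p.2) := by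
      rw [← Complex.ofReal_mul, Complex.neg_re, Complex.ofReal_re]
    rw [e]
    linarith
  have h2 : ∀ ξ, ∫ r in (0)..β, F r ξ =
      𝓕 f ξ * charFun ν ((2 * Real.pi) • ξ) * (Complex.exp (-(β * c ξ)) - 1) := by
    intro ξ
    have hd : ∀ r ∈ uIcc 0 β, HasDerivAt
        (fun r : ℝ => 𝓕 f ξ * charFun ν ((2 * Real.pi) • ξ) * Complex.exp (-(r * c ξ)))
        (F r ξ) r := by
      intro r _
      have h := (((Complex.ofRealCLM.hasDerivAt (x := r)).mul_const (c ξ : ℂ)).neg.cexp).const_mul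
        (𝓕 f ξ * charFun ν ((2 * Real.pi) • ξ))
      refine h.congr_deriv ?_
      simp only [hF, fourier_laplacian_apply, Complex.ofRealCLM_apply, Pi.neg_apply]
      push_cast
      simp only [hc]
      push_cast
      ring
    rw [intervalIntegral.integral_eq_sub_of_hasDerivAt hd]
    · simp
      ring
    · exact Continuous.intervalIntegrable (by simp only [hF]; fun_prop) _ _
  have hintb : ∀ m : Measure (E d), IsProbabilityMeasure m →
      Integrable (fun ξ => 𝓕 f ξ * charFun m ((2 * Real.pi) • ξ)) := fun m _ => by
    refine (𝓕 f).integrable.mul_bdd (c := 1) ?_ (ae_of_all _ fun ξ => norm_charFun_le_one _)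
    have : Continuous (charFun m) := continuous_charFun
    exact Continuous.aestronglyMeasurable (by fun_prop)
  rw [h1, intervalIntegral.integral_of_le hβ, integral_integral_swap hint]
  simp_rw [← intervalIntegral.integral_of_le hβ, h2]
  rw [integral_eq_integral_fourier_mul_charFun, integral_eq_integral_fourier_mul_charFun,
    ← integral_add (hintb ν inferInstance)]
  · refine integral_congr_ae (ae_of_all _ fun ξ => ?_)
    simp only
    rw [hchar β hβ]
    ring
  · refine ((hintb (heatFlow ν β) inferInstance).sub (hintb ν inferInstance)).congr
      (ae_of_all _ fun ξ => ?_)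
    simp only [Pi.sub_apply]
    rw [hchar β hβ]
    ring

lemma fderiv_ofReal_comp {φ : E d → ℝ} (hφ : ContDiff ℝ ∞ φ) (x v : E d) :
    fderiv ℝ (fun y => (φ y : ℂ)) x v = (fderiv ℝ φ x v : ℂ) := by
  have h := (Complex.ofRealCLM.hasFDerivAt (x := φ x)).comp x
    ((hφ.differentiable (by simp)) x).hasFDerivAt
  have h' : HasFDerivAt (fun y => (φ y : ℂ)) (Complex.ofRealCLM.comp (fderiv ℝ φ x)) x := h
  rw [h'.fderiv]
  rfl

/-- The heat equation for `heatFlow ν`, tested with smooth compactly supported functions. -/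
lemma integral_heatFlow (ν : Measure (E d)) [IsProbabilityMeasure ν] {φ : E d → ℝ}
    (hφ : ContDiff ℝ ∞ φ) (hc : HasCompactSupport φ) {β : ℝ} (hβ : 0 ≤ β) :
    ∫ x, φ x ∂(heatFlow ν β) =
      ∫ x, φ x ∂ν + ∫ r in (0)..β, ∫ x, laplace φ x ∂(heatFlow ν r) := by
  have hc' : HasCompactSupport (fun y => (φ y : ℂ)) := hc.comp_left (g := Complex.ofReal) rfl
  have hφ' : ContDiff ℝ ∞ (fun y => (φ y : ℂ)) := Complex.ofRealCLM.contDiff.comp hφ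
  let f : 𝓢(E d, ℂ) := hc'.toSchwartzMap hφ'
  have hf : ∀ x, f x = (φ x : ℂ) := fun x => rfl
  have hΔ : ∀ x, Δ f x = (laplace φ x : ℂ) := by
    intro x
    rw [laplacian_eq_sum (EuclideanSpace.basisFun (Fin d) ℝ), _root_.sum_apply, laplace]
    push_cast
    refine Finset.sum_congr rfl fun i _ => ?_
    have h1 : ∀ y, ∂_{EuclideanSpace.basisFun (Fin d) ℝ i} f y = (partialDeriv i φ y : ℂ) := by
      intro y
      rw [lineDerivOp_apply_eq_fderiv, EuclideanSpace.basisFun_apply]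
      exact fderiv_ofReal_comp hφ y _
    rw [lineDerivOp_apply_eq_fderiv, funext h1, EuclideanSpace.basisFun_apply]
    exact fderiv_ofReal_comp (contDiff_partialDeriv i hφ) x _
  have h := integral_heatFlow_schwartz ν f hβ
  simp_rw [hf, hΔ, integral_complex_ofReal, intervalIntegral.integral_ofReal] at h
  exact_mod_cast h

end fourier

lemma stronglyMeasurable_integral_heatFlow (ν : Measure (E d)) [IsProbabilityMeasure ν]
    {φ : E d → ℝ} (hφ : Continuous φ) :
    StronglyMeasurable (fun r => ∫ x, φ x ∂(heatFlow ν r)) :=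
  StronglyMeasurable.integral_kernel (κ := ⟨heatFlow ν, measurable_heatFlow ν⟩)
    hφ.stronglyMeasurable

/-! ### Plane waves as limits of test functions -/

section partialDeriv

variable {f g : E d → ℝ}

lemma partialDeriv_mul (i : Fin d) (hf : ContDiff ℝ ∞ f) (hg : ContDiff ℝ ∞ g) (x : E d) :
    partialDeriv i (fun y => f y * g y) x =
      partialDeriv i f x * g x + f x * partialDeriv i g x := by
  unfold partialDeriv
  rw [fderiv_fun_mul (hf.differentiable (by simp) x) (hg.differentiable (by simp) x)]
  simp only [_root_.add_apply, _root_.smul_apply, smul_eq_mul]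
  ring

lemma partialDeriv_add (i : Fin d) (hf : ContDiff ℝ ∞ f) (hg : ContDiff ℝ ∞ g) (x : E d) :
    partialDeriv i (fun y => f y + g y) x = partialDeriv i f x + partialDeriv i g x := by
  unfold partialDeriv
  rw [fderiv_fun_add (hf.differentiable (by simp) x) (hg.differentiable (by simp) x)]
  rfl

lemma laplace_mul (hf : ContDiff ℝ ∞ f) (hg : ContDiff ℝ ∞ g) (x : E d) :
    laplace (fun y => f y * g y) x = laplace f x * g x +
      2 * ∑ i, partialDeriv i f x * partialDeriv i g x + f x * laplace g x := by
  unfold laplace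
  rw [Finset.sum_mul, Finset.mul_sum, Finset.mul_sum, ← Finset.sum_add_distrib,
    ← Finset.sum_add_distrib]
  refine Finset.sum_congr rfl fun i _ => ?_
  have hf' := contDiff_partialDeriv i hf
  have hg' := contDiff_partialDeriv i hg
  rw [funext (partialDeriv_mul i hf hg), partialDeriv_add i (hf'.mul hg) (hf.mul hg'),
    partialDeriv_mul i hf' hg, partialDeriv_mul i hf hg']
  ring

lemma partialDeriv_comp_smul (i : Fin d) (hf : ContDiff ℝ ∞ f) (ε : ℝ) (x : E d) :
    partialDeriv i (fun y => f (ε • y)) x = ε * partialDeriv i f (ε • x) := by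
  unfold partialDeriv
  have h := (hf.differentiable (by simp) (ε • x)).hasFDerivAt.comp x
    ((hasFDerivAt_id x).const_smul ε)
  have h' : HasFDerivAt (fun y => f (ε • y)) _ x := h
  rw [h'.fderiv]
  simp

lemma laplace_comp_smul (hf : ContDiff ℝ ∞ f) (ε : ℝ) (x : E d) :
    laplace (fun y => f (ε • y)) x = ε ^ 2 * laplace f (ε • x) := by
  unfold laplace
  rw [Finset.mul_sum]
  refine Finset.sum_congr rfl fun i _ => ?_
  have hf' := contDiff_partialDeriv i hf
  have hs : ContDiff ℝ ∞ (fun y : E d => partialDeriv i f (ε • y)) :=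
    hf'.comp (contDiff_id.const_smul ε)
  rw [funext (partialDeriv_comp_smul i hf ε), partialDeriv_mul i contDiff_const hs,
    partialDeriv_comp_smul i hf']
  simp [partialDeriv]
  ring

lemma contDiff_wave (ξ : E d) (θ : ℝ) :
    ContDiff ℝ ∞ (fun y : E d => Real.cos (inner ℝ y ξ + θ)) := by
  have h : ContDiff ℝ ∞ (fun y : E d => inner ℝ y ξ + θ) :=
    (contDiff_id.inner ℝ contDiff_const).add contDiff_const
  exact h.cos

/-- The phase shift `θ - π/2` writes the sine as a cosine, so that derivatives of plane waves are
again plane waves. -/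
lemma partialDeriv_wave (i : Fin d) (ξ : E d) (θ : ℝ) (x : E d) :
    partialDeriv i (fun y => Real.cos (inner ℝ y ξ + θ)) x =
      -ξ i * Real.cos (inner ℝ x ξ + (θ - Real.pi / 2)) := by
  have h : HasFDerivAt (fun y : E d => inner ℝ y ξ + θ) ((innerSL ℝ).flip ξ) x :=
    ((innerSL ℝ).flip ξ).hasFDerivAt.add_const θ
  have e : (innerSL ℝ).flip ξ (EuclideanSpace.single i (1 : ℝ)) = ξ i := by
    change inner ℝ (EuclideanSpace.single i (1 : ℝ)) ξ = ξ i
    simp [EuclideanSpace.inner_single_left]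
  rw [partialDeriv, h.cos.fderiv, ← add_sub_assoc, Real.cos_sub_pi_div_two, _root_.smul_apply, e,
    smul_eq_mul]
  ring

lemma laplace_wave (ξ : E d) (θ : ℝ) (x : E d) :
    laplace (fun y => Real.cos (inner ℝ y ξ + θ)) x =
      -(‖ξ‖ ^ 2) * Real.cos (inner ℝ x ξ + θ) := by
  rw [EuclideanSpace.real_norm_sq_eq, ← Finset.sum_neg_distrib, Finset.sum_mul, laplace]
  refine Finset.sum_congr rfl fun i _ => ?_
  rw [funext (partialDeriv_wave i ξ θ), partialDeriv_mul i contDiff_const (contDiff_wave _ _),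
    partialDeriv_wave]
  have e : inner ℝ x ξ + (θ - Real.pi / 2 - Real.pi / 2) = inner ℝ x ξ + θ - Real.pi := by ring
  rw [e, Real.cos_sub_pi]
  simp [partialDeriv]
  ring

end partialDeriv

/-- The plane waves are limits of test functions, boundedly together with their Laplacians. -/
lemma exists_testFunctions_tendsto_wave (ξ : E d) (θ : ℝ) :
    ∃ (φ : ℕ → E d → ℝ) (K : ℝ), (∀ n, ContDiff ℝ ∞ (φ n)) ∧ (∀ n, HasCompactSupport (φ n)) ∧
      (∀ n x, |φ n x| ≤ K) ∧ (∀ n x, |laplace (φ n) x| ≤ K) ∧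
      (∀ x, Filter.Tendsto (fun n => φ n x) Filter.atTop
        (nhds (Real.cos (inner ℝ x ξ + θ)))) ∧
      (∀ x, Filter.Tendsto (fun n => laplace (φ n) x) Filter.atTop
        (nhds (-(‖ξ‖ ^ 2) * Real.cos (inner ℝ x ξ + θ)))) := by
  let χ : ContDiffBump (0 : E d) := ⟨1, 2, one_pos, one_lt_two⟩
  have hχ : ContDiff ℝ ∞ (χ : E d → ℝ) := χ.contDiff
  have hχ0 : χ (0 : E d) = 1 := χ.one_of_mem_closedBall (by simp [χ])
  have hc := contDiff_wave ξ θ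
  obtain ⟨M, hM⟩ := exists_abs_le_of_hasCompactSupport (continuous_laplace hχ)
    (hasCompactSupport_laplace χ.hasCompactSupport)
  have hN := fun i => exists_abs_le_of_hasCompactSupport (contDiff_partialDeriv i hχ).continuous
    (hasCompactSupport_partialDeriv i χ.hasCompactSupport)
  choose N hN using hN
  have hs : ∀ ε : ℝ, ContDiff ℝ ∞ (fun x : E d => χ (ε • x)) := fun ε =>
    hχ.comp (contDiff_id.const_smul ε)
  have hform : ∀ (ε : ℝ) (x : E d), laplace (fun y => χ (ε • y) * Real.cos (inner ℝ y ξ + θ)) x =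
      ε ^ 2 * laplace χ (ε • x) * Real.cos (inner ℝ x ξ + θ) +
      2 * ∑ i, ε * partialDeriv i χ (ε • x) *
        (-ξ i * Real.cos (inner ℝ x ξ + (θ - Real.pi / 2))) +
      χ (ε • x) * (-(‖ξ‖ ^ 2) * Real.cos (inner ℝ x ξ + θ)) := by
    intro ε x
    rw [laplace_mul (hs ε) hc, laplace_comp_smul hχ, laplace_wave]
    simp_rw [partialDeriv_comp_smul _ hχ, partialDeriv_wave]
  -- the cutoffs are `χ (ε x)` with `ε = 1 / (n + 1)`
  have hε : Filter.Tendsto (fun n : ℕ => 1 / ((n : ℝ) + 1)) Filter.atTop (nhds 0) :=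
    tendsto_one_div_add_atTop_nhds_zero_nat
  have hM0 : 0 ≤ M := (abs_nonneg _).trans (hM 0)
  have hN0 : ∀ i, 0 ≤ N i := fun i => (abs_nonneg _).trans (hN i 0)
  have hχle : ∀ x, |χ x| ≤ 1 := fun x => abs_le.2 ⟨by linarith [χ.nonneg (x := x)], χ.le_one⟩
  refine ⟨fun n x => χ ((1 / ((n : ℝ) + 1)) • x) * Real.cos (inner ℝ x ξ + θ),
    1 + (M + 2 * ∑ i, N i * |ξ i| + ‖ξ‖ ^ 2), fun n => (hs _).mul hc, fun n => ?_, ?_, ?_, ?_, ?_⟩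
  · exact (χ.hasCompactSupport.comp_smul (by positivity)).mul_right
  · intro n x
    rw [abs_mul]
    have h1 : 0 ≤ M + 2 * ∑ i, N i * |ξ i| + ‖ξ‖ ^ 2 := by
      have : 0 ≤ ∑ i, N i * |ξ i| :=
        Finset.sum_nonneg fun i _ => mul_nonneg (hN0 i) (abs_nonneg _)
      positivity
    have h2 := mul_le_one₀ (hχle ((1 / ((n : ℝ) + 1)) • x)) (abs_nonneg _)
      (Real.abs_cos_le_one (inner ℝ x ξ + θ))
    linarith
  · intro n x
    have hε0 : 0 ≤ 1 / ((n : ℝ) + 1) := by positivity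
    have hε1 : 1 / ((n : ℝ) + 1) ≤ 1 := by
      rw [div_le_one (by positivity)]; linarith [n.cast_nonneg (α := ℝ)]
    simp only [hform]
    generalize 1 / ((n : ℝ) + 1) = ε at hε0 hε1
    have h1 : |ε ^ 2 * laplace χ (ε • x) * Real.cos (inner ℝ x ξ + θ)| ≤ M := by
      rw [abs_mul, abs_mul, abs_of_nonneg (by positivity : 0 ≤ ε ^ 2)]
      calc ε ^ 2 * |laplace χ (ε • x)| * |Real.cos (inner ℝ x ξ + θ)|
          ≤ 1 * M * 1 := by
            gcongr
            · exact pow_le_one₀ hε0 hε1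
            · exact hM _
            · exact Real.abs_cos_le_one _
        _ = M := by ring
    have h2 : |2 * ∑ i, ε * partialDeriv i χ (ε • x) *
        (-ξ i * Real.cos (inner ℝ x ξ + (θ - Real.pi / 2)))| ≤ 2 * ∑ i, N i * |ξ i| := by
      rw [abs_mul, abs_two]
      gcongr
      refine (Finset.abs_sum_le_sum_abs _ _).trans (Finset.sum_le_sum fun i _ => ?_)
      rw [abs_mul, abs_mul, abs_mul, abs_neg, abs_of_nonneg hε0]
      calc ε * |partialDeriv i χ (ε • x)| *
            (|ξ i| * |Real.cos (inner ℝ x ξ + (θ - Real.pi / 2))|)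
          ≤ 1 * N i * (|ξ i| * 1) := by
            gcongr
            · exact mul_nonneg zero_le_one (hN0 i)
            · exact hN i _
            · exact Real.abs_cos_le_one _
        _ = N i * |ξ i| := by ring
    have h3 : |χ (ε • x) * (-(‖ξ‖ ^ 2) * Real.cos (inner ℝ x ξ + θ))| ≤ ‖ξ‖ ^ 2 := by
      rw [abs_mul, abs_mul, abs_neg, abs_of_nonneg (by positivity : 0 ≤ ‖ξ‖ ^ 2)]
      calc |χ (ε • x)| * (‖ξ‖ ^ 2 * |Real.cos (inner ℝ x ξ + θ)|)
          ≤ 1 * (‖ξ‖ ^ 2 * 1) := by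
            gcongr
            · exact hχle _
            · exact Real.abs_cos_le_one _
        _ = ‖ξ‖ ^ 2 := by ring
    have := (abs_add_le _ _).trans (add_le_add ((abs_add_le _ _).trans (add_le_add h1 h2)) h3)
    linarith
  · intro x
    have h : Continuous fun ε : ℝ => χ (ε • x) * Real.cos (inner ℝ x ξ + θ) :=
      (hχ.continuous.comp (by fun_prop)).mul continuous_const
    exact (h.tendsto' 0 _ (by simp [hχ0])).comp hε
  · intro x
    simp only [hform]
    have hl := continuous_laplace hχ
    have hp := fun i => (contDiff_partialDeriv i hχ).continuous
    have hχc := hχ.continuous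
    have h : Continuous fun ε : ℝ => ε ^ 2 * laplace χ (ε • x) * Real.cos (inner ℝ x ξ + θ) +
        2 * ∑ i, ε * partialDeriv i χ (ε • x) *
          (-ξ i * Real.cos (inner ℝ x ξ + (θ - Real.pi / 2))) +
        χ (ε • x) * (-(‖ξ‖ ^ 2) * Real.cos (inner ℝ x ξ + θ)) := by fun_prop
    exact (h.tendsto' 0 _ (by simp [hχ0])).comp hε

/-- The characteristic function is determined by the integrals of the real plane waves. -/
lemma charFun_eq_integral_cos (m : Measure (E d)) [IsProbabilityMeasure m] (ξ : E d) :
    charFun m ξ = (∫ x, Real.cos (inner ℝ x ξ + 0) ∂m : ℝ) +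
      (∫ x, Real.cos (inner ℝ x ξ + (-(Real.pi / 2))) ∂m : ℝ) * Complex.I := by
  have hi : ∀ θ : ℝ, Integrable (fun x : E d => ((Real.cos (inner ℝ x ξ + θ) : ℝ) : ℂ)) m := by
    intro θ
    have hc := (contDiff_wave ξ θ).continuous
    refine Integrable.of_bound (by fun_prop) 1 (ae_of_all _ fun x => ?_)
    rw [Complex.norm_real]
    exact Real.abs_cos_le_one _
  rw [charFun_apply, ← integral_complex_ofReal, ← integral_complex_ofReal, ← integral_mul_const,
    ← integral_add (hi _) ((hi _).mul_const _)]
  refine integral_congr_ae (ae_of_all _ fun x => ?_)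
  simp only
  rw [Complex.exp_mul_I, add_zero, ← sub_eq_add_neg, Real.cos_sub_pi_div_two]
  push_cast
  rfl

/-! ### Solutions are time-changed heat flows -/

section time

variable {T : ℝ}

lemma map_val_timeMeasure (T : ℝ) :
    Measure.map Subtype.val (timeMeasure T) = volume.restrict (Icc 0 T) :=
  map_comap_subtype_coe measurableSet_Icc volume

instance isFiniteMeasure_timeMeasure (T : ℝ) : IsFiniteMeasure (timeMeasure T) := by
  constructor
  have h : Measure.map Subtype.val (timeMeasure T) univ = timeMeasure T univ := by
    rw [Measure.map_apply measurable_subtype_coe MeasurableSet.univ, preimage_univ]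
  rw [← h, map_val_timeMeasure]
  exact measure_lt_top _ _

/-- Functions on the time interval are extended to `ℝ` by composition with `projIcc`. -/
lemma setIntegral_timeMeasure (hT : 0 ≤ T) (F : Icc (0 : ℝ) T → ℝ) (t : Icc (0 : ℝ) T) :
    ∫ s in Iic t, F s ∂(timeMeasure T) = ∫ s in (0)..(t : ℝ), F (projIcc 0 T hT s) := by
  have h := (MeasurableEmbedding.subtype_coe
    (measurableSet_Icc (a := (0 : ℝ)) (b := T))).setIntegral_map (μ := timeMeasure T)
    (fun s => F (projIcc 0 T hT s)) (Iic (t : ℝ))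
  have hpre : (Subtype.val ⁻¹' Iic (t : ℝ) : Set (Icc (0 : ℝ) T)) = Iic t := rfl
  simp only [projIcc_val, hpre] at h
  rw [← h, map_val_timeMeasure, Measure.restrict_restrict measurableSet_Iic,
    intervalIntegral.integral_of_le t.2.1, ← integral_Icc_eq_integral_Ioc]
  congr 2
  ext s
  simp only [mem_inter_iff, mem_Iic, mem_Icc]
  exact ⟨fun h => ⟨h.2.1, h.1⟩, fun h => ⟨h.2, h.1, h.2.trans t.2.2⟩⟩

lemma integrable_timeMeasure_iff (hT : 0 ≤ T) (F : Icc (0 : ℝ) T → ℝ) :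
    Integrable F (timeMeasure T) ↔ IntegrableOn (fun s => F (projIcc 0 T hT s)) (Ioc 0 T) := by
  have h := (MeasurableEmbedding.subtype_coe
    (measurableSet_Icc (a := (0 : ℝ)) (b := T))).integrable_map_iff
    (μ := timeMeasure T) (g := fun s => F (projIcc 0 T hT s))
  rw [map_val_timeMeasure] at h
  rw [← integrableOn_Icc_iff_integrableOn_Ioc, IntegrableOn, h]
  simp [Function.comp_def]

end time

lemma generator_scalarDiffusion {T : ℝ} (a : Measure (E d) → ℝ) (μ : Flow d T) (φ : E d → ℝ)
    (x : E d) (t : Icc (0 : ℝ) T) :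
    generator (scalarDiffusion a T) 0 μ φ x t = a (μ t) * laplace φ x := by
  simp [generator, scalarDiffusion, laplace, Matrix.one_apply, Finset.mul_sum]

section solution

variable {T : ℝ} {S : Set (Measure (E d))} {a : Measure (E d) → ℝ} {ν : Measure (E d)}
  {μ : Flow d T}

lemma IsSolution.integral_eq
    (h : IsSolution (flowsIn S T) (scalarDiffusion a T) 0 ν μ) (hT : 0 ≤ T)
    {φ : E d → ℝ} (hφ : ContDiff ℝ ∞ φ) (hc : HasCompactSupport φ) (t : Icc (0 : ℝ) T) :
    ∫ x, φ x ∂(μ t) = ∫ x, φ x ∂ν + ∫ s in (0)..(t : ℝ), a (μ (projIcc 0 T hT s)) *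
      ∫ x, laplace φ x ∂(μ (projIcc 0 T hT s)) := by
  rw [h.weak_eq φ hφ hc t, setIntegral_timeMeasure hT]
  simp_rw [generator_scalarDiffusion, integral_const_mul]

/-- Only the values of `φ` on one ball enter, where `a(μ_t)` is integrable by assumption. -/
lemma IsSolution.integrable_mul (hd : 0 < d)
    (h : IsSolution (flowsIn S T) (scalarDiffusion a T) 0 ν μ)
    {φ : E d → ℝ} (hφ : Measurable φ) (hb : ∃ C, ∀ x, |φ x| ≤ C) {R : ℝ}
    (hR : ∀ x ∉ Metric.ball 0 R, φ x = 0) :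
    Integrable (fun s => a (μ s) * ∫ x, φ x ∂(μ s)) (timeMeasure T) := by
  have := h.isMarkov
  obtain ⟨C, hC⟩ := hb
  have h1 := h.integrable_diffusion 0 R ⟨0, hd⟩ ⟨0, hd⟩
  simp only [scalarDiffusion, Matrix.smul_apply, Matrix.one_apply_eq, smul_eq_mul, mul_one] at h1
  rw [← integrable_indicator_iff (MeasurableSet.univ.prod measurableSet_ball)] at h1
  have h2 := h1.bdd_mul (c := C) (f := fun p : Icc (0 : ℝ) T × E d => φ p.2)
    (hφ.comp measurable_snd).aestronglyMeasurable (ae_of_all _ fun p => hC p.2)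
  have h3 := h2.integral_compProd
  simp only [Kernel.prodMkLeft_apply, Kernel.const_apply] at h3
  refine h3.congr (ae_of_all _ fun s => ?_)
  simp only
  rw [← integral_const_mul]
  refine integral_congr_ae (ae_of_all _ fun x => ?_)
  by_cases hx : x ∈ Metric.ball 0 R
  · simp only
    rw [indicator_of_mem (by exact ⟨mem_univ _, hx⟩), mul_comm]
  · simp [hR x hx]

lemma exists_ball_of_hasCompactSupport {φ : E d → ℝ} (hc : HasCompactSupport φ) :
    ∃ R, ∀ x ∉ Metric.ball (0 : E d) R, φ x = 0 := by
  obtain ⟨R, hR⟩ := hc.isCompact.isBounded.subset_ball (0 : E d)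
  exact ⟨R, fun x hx => image_eq_zero_of_notMem_tsupport fun h => hx (hR h)⟩

/-- Solutions are vaguely continuous in time. -/
lemma IsSolution.continuous_integral (hd : 0 < d)
    (h : IsSolution (flowsIn S T) (scalarDiffusion a T) 0 ν μ) (hT : 0 ≤ T)
    {φ : E d → ℝ} (hφ : ContDiff ℝ ∞ φ) (hc : HasCompactSupport φ) :
    Continuous (fun t => ∫ x, φ x ∂(μ t)) := by
  obtain ⟨R, hR⟩ := exists_ball_of_hasCompactSupport (hasCompactSupport_laplace hc)
  have hi := h.integrable_mul hd (continuous_laplace hφ).measurable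
    (exists_abs_le_of_hasCompactSupport (continuous_laplace hφ) (hasCompactSupport_laplace hc)) hR
  rw [integrable_timeMeasure_iff hT] at hi
  simp_rw [h.integral_eq hT hφ hc]
  refine continuous_const.add ?_
  exact (continuousOn_iff_continuous_domRestrict.1 (continuousOn_primitive_Icc hT hi))

/-- A solution is tight enough that one ball carries a fixed proportion of every `μ_t`, by vague
continuity and compactness of `[0, T]`. -/
lemma IsSolution.exists_ball_le (hd : 0 < d)
    (h : IsSolution (flowsIn S T) (scalarDiffusion a T) 0 ν μ) (hT : 0 ≤ T) :
    ∃ R : ℝ, ∀ t, 1 / 4 ≤ (μ t).real (Metric.ball 0 R) := by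
  have := h.isMarkov
  let χ : ℕ → ContDiffBump (0 : E d) := fun n =>
    ⟨(n : ℝ) + 1, (n : ℝ) + 2, by positivity, by linarith⟩
  have hcont : ∀ n, Continuous fun t => ∫ x, χ n x ∂(μ t) := fun n =>
    h.continuous_integral hd hT (χ n).contDiff (χ n).hasCompactSupport
  have hint : ∀ n t, Integrable (χ n) (μ t) := fun n t =>
    Integrable.of_bound (χ n).continuous.aestronglyMeasurable 1 (ae_of_all _ fun x => by
      rw [Real.norm_eq_abs, abs_of_nonneg (χ n).nonneg]; exact (χ n).le_one)
  have hlow : ∀ (n : ℕ) t, (μ t).real (Metric.closedBall 0 ((n : ℝ) + 1)) ≤ ∫ x, χ n x ∂(μ t) := by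
    intro n t
    rw [← integral_indicator_one Metric.isClosed_closedBall.measurableSet]
    refine integral_mono ((integrable_const (1 : ℝ)).indicator
      Metric.isClosed_closedBall.measurableSet) (hint n t) fun x => ?_
    by_cases hx : x ∈ Metric.closedBall (0 : E d) ((n : ℝ) + 1)
    · rw [indicator_of_mem hx]; exact ((χ n).one_of_mem_closedBall hx).ge
    · rw [indicator_of_notMem hx]; exact (χ n).nonneg
  have hup : ∀ (n : ℕ) t, ∫ x, χ n x ∂(μ t) ≤ (μ t).real (Metric.ball 0 ((n : ℝ) + 2)) := by
    intro n t
    rw [← integral_indicator_one measurableSet_ball]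
    refine integral_mono (hint n t) ((integrable_const (1 : ℝ)).indicator
      measurableSet_ball) fun x => ?_
    by_cases hx : x ∈ Metric.ball (0 : E d) ((n : ℝ) + 2)
    · rw [indicator_of_mem hx]; exact (χ n).le_one
    · rw [indicator_of_notMem hx]
      have : x ∉ Function.support (χ n) := by rw [(χ n).support_eq]; exact hx
      exact (Function.notMem_support.1 this).le
  -- `χ n` equals `1` on the support of `χ (n - 1)`, hence the open cover of `[0, T]` is increasing
  obtain ⟨n, hn⟩ := isCompact_univ.elim_directed_cover
    (fun n => {t | 1 / 4 < ∫ x, χ n x ∂(μ t)})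
    (fun n => isOpen_lt continuous_const (hcont n)) (fun t _ => by
      have ht : Filter.Tendsto (fun n : ℕ => (μ t) (Metric.closedBall 0 ((n : ℝ) + 1)))
          Filter.atTop (nhds ((μ t) (⋃ n : ℕ, Metric.closedBall 0 ((n : ℝ) + 1)))) :=
        tendsto_measure_iUnion_atTop fun m n hmn => Metric.closedBall_subset_closedBall (by
          have : (m : ℝ) ≤ n := by exact_mod_cast hmn
          linarith)
      have hU : (⋃ n : ℕ, Metric.closedBall (0 : E d) ((n : ℝ) + 1)) = univ := by
        refine eq_univ_of_forall fun x => ?_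
        obtain ⟨n, hn⟩ := exists_nat_ge ‖x‖
        exact mem_iUnion.2 ⟨n, by simpa using hn.trans (by linarith)⟩
      rw [hU, measure_univ] at ht
      have ht' := (ENNReal.tendsto_toReal ENNReal.one_ne_top).comp ht
      obtain ⟨n, hn⟩ := (ht'.eventually_const_lt
        (by norm_num : (1 / 4 : ℝ) < (1 : ENNReal).toReal)).exists
      exact mem_iUnion.2 ⟨n, lt_of_lt_of_le hn (hlow n t)⟩)
    (directed_of_isDirected_le (monotone_nat_of_le_succ fun n t ht => by
      refine lt_of_lt_of_le ht (((hup n t).trans ?_).trans (hlow (n + 1) t))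
      refine measureReal_mono (Metric.ball_subset_closedBall.trans
        (Metric.closedBall_subset_closedBall ?_))
      push_cast
      linarith))
  exact ⟨_, fun t => (le_of_lt (hn (mem_univ t))).trans (hup n t)⟩

/-- The integrability of `a(μ_t)` over `U × [0, T]` for balls `U` improves to integrability in time:
divide by `μ_t(U)` for a ball `U` with `μ_t(U) ≥ 1/4`. -/
lemma IsSolution.integrable_coeff (hd : 0 < d)
    (h : IsSolution (flowsIn S T) (scalarDiffusion a T) 0 ν μ) (hT : 0 ≤ T) :
    Integrable (fun s => a (μ s)) (timeMeasure T) := by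
  have := h.isMarkov
  obtain ⟨R, hR⟩ := h.exists_ball_le hd hT
  have h1 := h.integrable_mul hd (φ := (Metric.ball 0 R).indicator 1) (R := R)
    (measurable_one.indicator measurableSet_ball) ⟨1, fun x => by
      by_cases hx : x ∈ Metric.ball (0 : E d) R <;> simp [hx]⟩
    (fun x hx => indicator_of_notMem hx _)
  simp_rw [integral_indicator_one measurableSet_ball] at h1
  have hm : Measurable fun s => ((μ s).real (Metric.ball 0 R))⁻¹ :=
    (μ.measurable_coe measurableSet_ball).ennreal_toReal.inv
  refine (h1.mul_bdd (c := 4) hm.aestronglyMeasurable (ae_of_all _ fun s => ?_)).congr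
    (ae_of_all _ fun s => ?_)
  · have := hR s
    rw [Real.norm_eq_abs, abs_of_nonneg (by positivity), inv_le_comm₀ (by linarith) (by norm_num)]
    linarith
  · have := hR s
    have hne : (μ s).real (Metric.ball 0 R) ≠ 0 := by linarith
    simp only
    field_simp

/-- The weak equation extends from test functions to plane waves. -/
lemma IsSolution.integral_wave_eq (hd : 0 < d)
    (h : IsSolution (flowsIn S T) (scalarDiffusion a T) 0 ν μ) (hT : 0 ≤ T)
    [IsProbabilityMeasure ν] (ξ : E d) (θ : ℝ) (t : Icc (0 : ℝ) T) :
    ∫ x, Real.cos (inner ℝ x ξ + θ) ∂(μ t) = ∫ x, Real.cos (inner ℝ x ξ + θ) ∂ν -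
      ‖ξ‖ ^ 2 * ∫ s in (0)..(t : ℝ), a (μ (projIcc 0 T hT s)) *
        ∫ x, Real.cos (inner ℝ x ξ + θ) ∂(μ (projIcc 0 T hT s)) := by
  have := h.isMarkov
  obtain ⟨φ, K, hφ, hc, hK, hΔK, hlim, hΔlim⟩ := exists_testFunctions_tendsto_wave ξ θ
  have hconv : ∀ m : Measure (E d), IsProbabilityMeasure m →
      Filter.Tendsto (fun n => ∫ x, φ n x ∂m) Filter.atTop
        (nhds (∫ x, Real.cos (inner ℝ x ξ + θ) ∂m)) := fun m _ =>
    tendsto_integral_of_dominated_convergence (fun _ => K)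
      (fun n => (hφ n).continuous.aestronglyMeasurable) (integrable_const _)
      (fun n => ae_of_all _ (hK n)) (ae_of_all _ hlim)
  have hΔconv : ∀ m : Measure (E d), IsProbabilityMeasure m →
      Filter.Tendsto (fun n => ∫ x, laplace (φ n) x ∂m) Filter.atTop
        (nhds (∫ x, -(‖ξ‖ ^ 2) * Real.cos (inner ℝ x ξ + θ) ∂m)) := fun m _ =>
    tendsto_integral_of_dominated_convergence (fun _ => K)
      (fun n => (continuous_laplace (hφ n)).aestronglyMeasurable) (integrable_const _)
      (fun n => ae_of_all _ (hΔK n)) (ae_of_all _ hΔlim)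
  have hg := (integrable_timeMeasure_iff hT _).1 (h.integrable_coeff hd hT)
  have hgt : IntegrableOn (fun s => a (μ (projIcc 0 T hT s))) (Ioc 0 (t : ℝ)) :=
    hg.mono_set (Ioc_subset_Ioc_right t.2.2)
  have hproj : Measurable (projIcc 0 T hT) := continuous_projIcc.measurable
  have hlimit := intervalIntegral.tendsto_integral_filter_of_dominated_convergence
    (a := 0) (b := t) (μ := volume) (l := Filter.atTop)
    (F := fun n s => a (μ (projIcc 0 T hT s)) * ∫ x, laplace (φ n) x ∂(μ (projIcc 0 T hT s)))
    (f := fun s => a (μ (projIcc 0 T hT s)) *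
      ∫ x, -(‖ξ‖ ^ 2) * Real.cos (inner ℝ x ξ + θ) ∂(μ (projIcc 0 T hT s)))
    (fun s => |a (μ (projIcc 0 T hT s))| * K)
    (Filter.Eventually.of_forall fun n => by
      rw [uIoc_of_le t.2.1]
      refine hgt.1.mul ?_
      exact ((continuous_laplace (hφ n)).stronglyMeasurable.integral_kernel (κ := μ)
        |>.comp_measurable hproj).aestronglyMeasurable)
    (Filter.Eventually.of_forall fun n => ae_of_all _ fun s _ => by
      rw [norm_mul, Real.norm_eq_abs]
      refine mul_le_mul_of_nonneg_left ?_ (abs_nonneg _)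
      have := norm_integral_le_of_norm_le_const (μ := μ (projIcc 0 T hT s))
        (f := laplace (φ n)) (C := K) (ae_of_all _ fun x => hΔK n x)
      simpa using this)
    ((intervalIntegrable_iff_integrableOn_Ioc_of_le t.2.1).2 (hgt.abs.mul_const K))
    (ae_of_all _ fun s _ => (hΔconv _ inferInstance).const_mul _)
  have hfinal := tendsto_nhds_unique (hconv (μ t) inferInstance)
    (((hconv ν inferInstance).add hlimit).congr fun n => (h.integral_eq hT (hφ n) (hc n) t).symm)
  rw [hfinal, sub_eq_add_neg, ← neg_mul, ← intervalIntegral.integral_const_mul]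
  congr 2
  ext s
  rw [integral_const_mul]
  ring

end solution

/-- Uniqueness for the linear equation: a solution is the heat flow run with the clock
`t ↦ ∫_0^t a(μ_s) ds`. -/
lemma IsSolution.eq_heatFlow (hd : 0 < d) {T : ℝ} {S : Set (Measure (E d))}
    {a : Measure (E d) → ℝ} (ha : ∀ σ ∈ S, 0 ≤ a σ) {ν : Measure (E d)} [IsProbabilityMeasure ν]
    {μ : Flow d T} (h : IsSolution (flowsIn S T) (scalarDiffusion a T) 0 ν μ) (hT : 0 ≤ T)
    (t : Icc (0 : ℝ) T) :
    μ t = heatFlow ν (∫ s in (0)..(t : ℝ), a (μ (projIcc 0 T hT s))) := by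
  have := h.isMarkov
  have hgi := (integrable_timeMeasure_iff hT _).1 (h.integrable_coeff hd hT)
  have hg0 : ∀ s ∈ Ioc 0 T, 0 ≤ a (μ (projIcc 0 T hT s)) := fun s _ => ha _ (h.mem_dom _)
  have hproj : Measurable (projIcc 0 T hT) := continuous_projIcc.measurable
  have hcos : ∀ (ξ : E d) (θ : ℝ), ∫ x, Real.cos (inner ℝ x ξ + θ) ∂(μ t) =
      (∫ x, Real.cos (inner ℝ x ξ + θ) ∂ν) *
        Real.exp (-(‖ξ‖ ^ 2 * ∫ s in (0)..(t : ℝ), a (μ (projIcc 0 T hT s)))) := by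
    intro ξ θ
    have := eq_exp_primitive hT hg0 hgi (K := 1) (c := ‖ξ‖ ^ 2)
      (h := fun s => ∫ x, Real.cos (inner ℝ x ξ + θ) ∂(μ (projIcc 0 T hT s)))
      (h₀ := ∫ x, Real.cos (inner ℝ x ξ + θ) ∂ν)
      (((contDiff_wave ξ θ).continuous.stronglyMeasurable.integral_kernel (κ := μ)
        |>.comp_measurable hproj).measurable)
      (fun s => by
        have := norm_integral_le_of_norm_le_const (μ := μ (projIcc 0 T hT s))
          (f := fun x => Real.cos (inner ℝ x ξ + θ)) (C := 1)
          (ae_of_all _ fun x => Real.abs_cos_le_one _)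
        simpa using this)
      (fun s hs => by
        have := h.integral_wave_eq hd hT ξ θ ⟨s, hs⟩
        beta_reduce
        rw [projIcc_of_mem hT hs]
        exact this) t.2
    simpa only [projIcc_val] using this
  refine Measure.ext_of_charFun (funext fun ξ => ?_)
  rw [charFun_heatFlow ν (primitive_mem_Icc hT hg0 hgi t.2).1, charFun_eq_integral_cos,
    charFun_eq_integral_cos ν, hcos, hcos]
  push_cast
  rw [mul_comm ((‖ξ‖ : ℂ) ^ 2)]
  ring

/-! ### The integral criterion -/

/-- The constant flow `ν` is a solution, since `a ν = 0`. -/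
lemma isSolution_stationary {S : Set (Measure (E d))} {a : Measure (E d) → ℝ} {ν : Measure (E d)}
    [IsProbabilityMeasure ν] (hν : ν ∈ S) (h0 : a ν = 0) (T : ℝ) :
    IsSolution (flowsIn S T) (scalarDiffusion a T) 0 ν (stationary ν T) := by
  refine ⟨?_, fun _ => hν, fun z r i j => ?_, fun z r i => ?_, fun φ _ _ t => ?_⟩
  · unfold stationary; infer_instance
  · simp [scalarDiffusion, stationary, h0]
  · simp
  · simp [generator_scalarDiffusion, stationary, h0]

/-- A nonstationary solution forces `∫_0^ε dβ / f(β) < ∞`: with `t = τ(β)` the inverse of the clock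
`B(t) = ∫_0^t a(μ_s) ds`, one has `f(β) = a(μ_{τ(β)})`, and the change of variables bounds
`∫_0^{B(T)} dβ / f(β)` by `T`. -/
lemma IsSolution.exists_integrableOn (hd : 0 < d) {T : ℝ} {S : Set (Measure (E d))}
    {a : Measure (E d) → ℝ} (ha : ∀ σ ∈ S, 0 ≤ a σ) {ν : Measure (E d)} [IsProbabilityMeasure ν]
    {μ : Flow d T} (h : IsSolution (flowsIn S T) (scalarDiffusion a T) 0 ν μ) (hT : 0 ≤ T)
    (hne : μ ≠ stationary ν T) :
    ∃ L : ℝ, 0 < L ∧ (∀ β ∈ Ioc 0 L, heatEvolution ν β ∈ S) ∧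
      IntegrableOn (fun β => 1 / a (heatEvolution ν β)) (Ioc 0 L) := by
  have hgi := (integrable_timeMeasure_iff hT _).1 (h.integrable_coeff hd hT)
  have hg0 : ∀ s ∈ Ioc 0 T, 0 ≤ a (μ (projIcc 0 T hT s)) := fun s _ => ha _ (h.mem_dom _)
  set g : ℝ → ℝ := fun s => a (μ (projIcc 0 T hT s)) with hg
  have heq : ∀ t, μ t = heatFlow ν (∫ s in (0)..(t : ℝ), g s) := h.eq_heatFlow hd ha hT
  have hL : 0 < ∫ s in (0)..T, g s := by
    by_contra hcon
    refine hne (Kernel.ext fun t => ?_)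
    have := (primitive_mem_Icc hT hg0 hgi t.2).2
    rw [heq t, heatFlow_of_nonpos ν (this.trans (not_lt.1 hcon))]
    rfl
  have hτ : ∀ β ∈ Ioc 0 (∫ s in (0)..T, g s),
      μ (projIcc 0 T hT (primitiveInv g T β)) = heatEvolution ν β := by
    intro β hβ
    rw [heq, projIcc_of_mem hT (primitiveInv_mem_Icc hT β),
      primitive_primitiveInv hT hg0 hgi ⟨hβ.1.le, hβ.2⟩, heatFlow_of_pos ν hβ.1]
  refine ⟨_, hL, fun β hβ => hτ β hβ ▸ h.mem_dom _, ?_⟩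
  have hm : AEStronglyMeasurable (fun s => (g s)⁻¹) (volume.restrict (Ioc 0 T)) :=
    hgi.1.aemeasurable.inv.aestronglyMeasurable
  -- `g * g⁻¹` is the indicator of `{g ≠ 0}`, as `0⁻¹ = 0`
  have hb : IntegrableOn (fun s => g s * (g s)⁻¹) (Ioc 0 T) :=
    Integrable.of_bound (hgi.1.mul hm) 1 (ae_of_all _ fun s => by
      by_cases hs : g s = 0 <;> simp [hs])
  refine ((integrableOn_comp_primitiveInv_iff hT hg0 hgi hm).2 hb).congr_fun
    (fun β hβ => ?_) measurableSet_Ioc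
  beta_reduce
  rw [one_div, ← hτ β hβ]

section delay

variable {F : ℝ → ℝ} {t₀ t : ℝ}

/-- Since `F 0 = 0`, waiting until `t₀` before running `F` amounts to translating its restriction to
positive times. -/
lemma delay_eqOn_indicator (h0 : F 0 = 0) :
    EqOn (fun s => F (max (s - t₀) 0))
      (fun s => (Ioc 0 (max (t - t₀) 0)).indicator F (s - t₀)) (Ioc 0 t) := by
  intro s hs
  simp only
  rcases le_or_gt s t₀ with h | h
  · rw [max_eq_right (by linarith), h0, indicator_of_notMem]
    exact fun hm => absurd hm.1 (by linarith)
  · rw [max_eq_left (by linarith), indicator_of_mem]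
    exact ⟨by linarith, le_max_of_le_left (by linarith [hs.2])⟩

lemma integrableOn_delay (h0 : F 0 = 0) (hF : IntegrableOn F (Ioc 0 (max (t - t₀) 0))) :
    IntegrableOn (fun s => F (max (s - t₀) 0)) (Ioc 0 t) :=
  ((((integrable_indicator_iff measurableSet_Ioc).2 hF).comp_sub_right t₀).integrableOn).congr_fun
    (delay_eqOn_indicator h0).symm measurableSet_Ioc

lemma intervalIntegral_delay (h0 : F 0 = 0) (ht₀ : 0 ≤ t₀) (ht : 0 ≤ t) :
    ∫ s in (0)..t, F (max (s - t₀) 0) = ∫ s in (0)..max (t - t₀) 0, F s := by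
  rw [intervalIntegral.integral_of_le ht, intervalIntegral.integral_of_le (le_max_right _ _),
    setIntegral_congr_fun measurableSet_Ioc (delay_eqOn_indicator h0),
    setIntegral_eq_integral_of_forall_compl_eq_zero, integral_sub_right_eq_self,
    integral_indicator measurableSet_Ioc]
  intro s hs
  refine indicator_of_notMem (fun hm => hs ⟨by linarith [hm.1], ?_⟩) _
  rcases le_max_iff.1 hm.2 with h | h
  · linarith
  · linarith [hm.1]

end delay

/-- If `∫_0^ε dβ / f(β) < ∞` then there is a nonstationary solution: the heat flow run with the
clock `τ` inverse to `G(β) = ∫_0^β dr / f(r)`. Waiting at `ν` first produces a solution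
on an arbitrarily long interval. -/
lemma exists_nonstationary_solution (hd : 0 < d) {S : Set (Measure (E d))}
    {a : Measure (E d) → ℝ} (ha : ∀ σ ∈ S, 0 ≤ a σ) {ν : Measure (E d)} [IsProbabilityMeasure ν]
    (hν : ν ∈ S) (hzero : ∀ σ ∈ S, a σ = 0 ↔ σ = ν) {ε : ℝ} (hε : 0 < ε)
    (hS : ∀ β ∈ Ioc 0 ε, heatEvolution ν β ∈ S)
    (hi : IntegrableOn (fun β => 1 / a (heatEvolution ν β)) (Ioc 0 ε)) {T : ℝ} (hT : 0 < T) :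
    ∃ μ : Flow d T, μ ≠ stationary ν T ∧
      IsSolution (flowsIn S T) (scalarDiffusion a T) 0 ν μ := by
  have haν : a ν = 0 := (hzero ν hν).2 rfl
  set f : ℝ → ℝ := fun β => a (heatFlow ν β) with hf
  set g : ℝ → ℝ := fun β => 1 / f β with hg
  have hfpos : ∀ β ∈ Ioc 0 ε, 0 < f β := by
    intro β hβ
    simp only [hf, heatFlow_of_pos ν hβ.1]
    refine lt_of_le_of_ne (ha _ (hS β hβ)) fun h => ?_
    exact heatEvolution_ne hd ν hβ.1 ((hzero _ (hS β hβ)).1 h.symm)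
  have hgi : IntegrableOn g (Ioc 0 ε) := hi.congr_fun (fun β hβ => by
    simp only [hg, hf, heatFlow_of_pos ν hβ.1]) measurableSet_Ioc
  have hg0 : ∀ β ∈ Ioc 0 ε, 0 ≤ g β := fun β hβ => (one_div_pos.2 (hfpos β hβ)).le
  have hL : 0 < ∫ β in (0)..ε, g β :=
    intervalIntegral.intervalIntegral_pos_of_pos_on
      ((intervalIntegrable_iff_integrableOn_Ioc_of_le hε.le).2 hgi)
      (fun β hβ => one_div_pos.2 (hfpos β ⟨hβ.1, hβ.2.le⟩)) hε
  set L := ∫ β in (0)..ε, g β with hLdef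
  set τ : ℝ → ℝ := primitiveInv g ε with hτ
  have hτmem : ∀ s, τ s ∈ Icc 0 ε := primitiveInv_mem_Icc hε.le
  have hGτ : ∀ s ∈ Icc 0 L, ∫ β in (0)..τ s, g β = s := fun s hs =>
    primitive_primitiveInv hε.le hg0 hgi hs
  have hτ0 : τ 0 = 0 := le_antisymm
    ((primitiveInv_le_iff hε.le hg0 hgi hL.le ⟨le_rfl, hε.le⟩).2 (by simp)) (hτmem 0).1
  have hτpos : ∀ s ∈ Ioc 0 L, 0 < τ s := by
    intro s hs
    refine lt_of_le_of_ne (hτmem s).1 fun h => ?_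
    have := hGτ s ⟨hs.1.le, hs.2⟩
    rw [← h, intervalIntegral.integral_same] at this
    exact hs.1.ne this
  -- the flow moves during the last `δ` units of time only
  set δ := min T L with hδ
  set t₀ := T - δ with ht₀
  have hδpos : 0 < δ := lt_min hT hL
  have ht₀nn : 0 ≤ t₀ := sub_nonneg.2 (min_le_left _ _)
  set σ : ℝ → ℝ := fun t => max (t - t₀) 0 with hσ
  have hσmem : ∀ t ≤ T, σ t ∈ Icc 0 L := fun t ht =>
    ⟨le_max_right _ _, max_le ((by linarith : t - t₀ ≤ δ).trans (min_le_right _ _)) hL.le⟩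
  have hmeas : Measurable fun t : Icc (0 : ℝ) T => heatFlow ν (τ (σ t)) := by
    refine (measurable_heatFlow ν).comp ((measurable_primitiveInv hε.le).comp ?_)
    simp only [hσ]
    fun_prop
  have hmemS : ∀ s, heatFlow ν (τ s) ∈ S := by
    intro s
    rcases (hτmem s).1.eq_or_lt with h | h
    · rw [← h, heatFlow_of_nonpos ν le_rfl]; exact hν
    · rw [heatFlow_of_pos ν h]; exact hS _ ⟨h, (hτmem s).2⟩
  have hf0 : f (τ 0) = 0 := by simp only [hf, hτ0, heatFlow_of_nonpos ν le_rfl, haν]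
  have hfm : AEStronglyMeasurable f (volume.restrict (Ioc 0 ε)) := by
    have : AEMeasurable (fun β => (g β)⁻¹) (volume.restrict (Ioc 0 ε)) := hgi.1.aemeasurable.inv
    simpa [hg] using this.aestronglyMeasurable
  have hgf : ∀ β ∈ Ioc 0 ε, g β * f β = 1 := fun β hβ => one_div_mul_cancel (hfpos β hβ).ne'
  have hfτ : IntegrableOn (fun s => f (τ s)) (Ioc 0 L) := by
    refine (integrableOn_comp_primitiveInv_iff hε.le hg0 hgi hfm).2 ?_
    exact (integrableOn_const (μ := volume) (s := Ioc 0 ε) (C := (1 : ℝ)) (by simp)).congr_fun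
      (fun β hβ => (hgf β hβ).symm) measurableSet_Ioc
  have hfσ : IntegrableOn (fun t => f (τ (σ t))) (Ioc 0 T) :=
    integrableOn_delay (F := fun s => f (τ s)) hf0
      (hfτ.mono_set (Ioc_subset_Ioc_right (hσmem T le_rfl).2))
  let μ : Flow d T := ⟨fun t => heatFlow ν (τ (σ t)), hmeas⟩
  have hμ : ∀ t, μ t = heatFlow ν (τ (σ t)) := fun t => rfl
  have hMarkov : IsMarkovKernel μ := ⟨fun t => by rw [hμ]; infer_instance⟩
  have haμ : Integrable (fun t => a (μ t)) (timeMeasure T) := by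
    rw [integrable_timeMeasure_iff hT.le]
    refine hfσ.congr_fun (fun t ht => ?_) measurableSet_Ioc
    simp only [hμ, projIcc_of_mem hT.le (Ioc_subset_Icc_self ht), hf]
  refine ⟨μ, fun hcon => ?_, hMarkov, fun t => hmemS _, fun z r i j => ?_, fun z r i => ?_,
    fun φ hφ hc t => ?_⟩
  · -- at the final time the flow has left `ν`
    have hσT : σ T = δ := by
      simp only [hσ, ht₀, sub_sub_cancel]
      exact max_eq_left hδpos.le
    have h1 : μ ⟨T, hT.le, le_rfl⟩ = ν := by rw [hcon]; rfl
    have hpos := hτpos δ ⟨hδpos, min_le_right _ _⟩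
    rw [hμ] at h1
    simp only [hσT, heatFlow_of_pos ν hpos] at h1
    exact heatEvolution_ne hd ν hpos h1
  · have h1 : Integrable (fun p : Icc (0 : ℝ) T × E d => a (μ p.1)) (spaceTime μ) := by
      have h2 : Integrable (fun t => a (μ t)) ((timeMeasure T).compProd μ).fst := by
        rwa [Measure.fst_compProd]
      exact h2.comp_measurable measurable_fst
    simp only [scalarDiffusion, Matrix.smul_apply, smul_eq_mul]
    exact (h1.mul_const _).integrableOn
  · simp
  · have hW : StronglyMeasurable fun r => ∫ x, laplace φ x ∂(heatFlow ν r) :=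
      stronglyMeasurable_integral_heatFlow ν (continuous_laplace hφ)
    rw [setIntegral_timeMeasure hT.le]
    simp_rw [generator_scalarDiffusion, integral_const_mul]
    have e1 : ∫ s in (0)..(t : ℝ), a (μ (projIcc 0 T hT.le s)) *
          ∫ x, laplace φ x ∂(μ (projIcc 0 T hT.le s)) =
        ∫ s in (0)..(t : ℝ), f (τ (σ s)) * ∫ x, laplace φ x ∂(heatFlow ν (τ (σ s))) := by
      refine intervalIntegral.integral_congr fun s hs => ?_
      rw [uIcc_of_le t.2.1] at hs
      simp only [hμ, projIcc_of_mem hT.le ⟨hs.1, hs.2.trans t.2.2⟩, hf]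
    rw [e1, intervalIntegral_delay (t₀ := t₀)
      (F := fun s => f (τ s) * ∫ x, laplace φ x ∂(heatFlow ν (τ s)))
      (by simp only [hf0, zero_mul]) ht₀nn t.2.1]
    have hσt := hσmem t t.2.2
    -- the integrand becomes `g f ∫ Δφ = ∫ Δφ` in the variable `β = τ(s)`
    have e2 := intervalIntegral_comp_primitiveInv hε.le hg0 hgi
      (u := fun β => f β * ∫ x, laplace φ x ∂(heatFlow ν β))
      (hfm.mul hW.aestronglyMeasurable) (hτmem (σ t))
    rw [hGτ _ hσt] at e2
    rw [e2, hμ, integral_heatFlow ν hφ hc (hτmem (σ t)).1]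
    congr 1
    rw [intervalIntegral.integral_of_le (hτmem _).1, intervalIntegral.integral_of_le (hτmem _).1]
    refine setIntegral_congr_fun measurableSet_Ioc fun β hβ => ?_
    rw [← mul_assoc, hgf β ⟨hβ.1, hβ.2.trans (hτmem _).2⟩, one_mul]

end FPK

theorem theorem4 (d : ℕ) (hd : 0 < d)
    (S : Set (Measure (FPK.E d))) (hS : ∀ σ ∈ S, IsProbabilityMeasure σ)
    (a : Measure (FPK.E d) → ℝ) (ha : ∀ σ ∈ S, 0 ≤ a σ)
    (ν : Measure (FPK.E d)) (hν : ν ∈ S) (hzero : ∀ σ ∈ S, a σ = 0 ↔ σ = ν) :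
    (∀ T : ℝ, 0 < T →
      FPK.IsSolution (FPK.flowsIn S T) (FPK.scalarDiffusion a T) 0 ν (FPK.stationary ν T)) ∧
    ((∀ T : ℝ, 0 < T → ∃ μ : FPK.Flow d T, μ ≠ FPK.stationary ν T ∧
        FPK.IsSolution (FPK.flowsIn S T) (FPK.scalarDiffusion a T) 0 ν μ) ↔
      ∃ ε₀ : ℝ, 0 < ε₀ ∧ ∀ ε ∈ Ioc 0 ε₀,
        (∀ β ∈ Ioo 0 ε, FPK.heatEvolution ν β ∈ S) ∧
          IntegrableOn (fun β => 1 / a (FPK.heatEvolution ν β)) (Ioo 0 ε)) := by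
  have := hS ν hν
  refine ⟨fun T _ => FPK.isSolution_stationary hν ((hzero ν hν).2 rfl) T, fun h => ?_, ?_⟩
  · obtain ⟨μ, hne, hμ⟩ := h 1 one_pos
    obtain ⟨L, hL, hmem, hint⟩ := hμ.exists_integrableOn hd ha zero_le_one hne
    exact ⟨L, hL, fun ε hε => ⟨fun β hβ => hmem β ⟨hβ.1, hβ.2.le.trans hε.2⟩,
      hint.mono_set (Ioo_subset_Ioc_self.trans (Ioc_subset_Ioc_right hε.2))⟩⟩
  · rintro ⟨ε₀, hε₀, h⟩ T hT
    obtain ⟨hmem, hint⟩ := h ε₀ ⟨hε₀, le_rfl⟩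
    have hsub : Ioc 0 (ε₀ / 2) ⊆ Ioo 0 ε₀ := fun β hβ => ⟨hβ.1, by linarith [hβ.2]⟩
    exact FPK.exists_nonstationary_solution hd ha hν hzero (half_pos hε₀)
      (fun β hβ => hmem β (hsub hβ)) (hint.mono_set hsub) hT
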